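/- Conventions. For a group $G$, $BG$ is the simplicial set with $BG_m=\{[g_1,\dots,g_m] : g_i\in G\}$, faces $d_0[g_1,\dots,g_m]=[g_2,\dots,g_m]$, $d_i[g_1,\dots,g_m]=[g_1,\dots,g_ig_{i+1},\dots,g_m]$ for $1\le i\le m-1$, $d_m[g_1,\dots,g_m]=[g_1,\dots,g_{m-1}]$, and degeneracies inserting the identity element. The Moore complex $\mathbb{Z}BG_*$ is free abelian on all simplices, with $\partial=\sum_i(-1)^i d_i$; the cellular chain complex $C_*(BG)$ is the quotient of $\mathbb{Z}BG_*$ by the subcomplex generated by the degenerate simplices, with basis the nondegenerate simplices. The mitosis of $G$ is $\mathcal{A}(G)=\langle G,u,t \mid tat^{-1}=a\cdot uau^{-1},\ [uau^{-1},b]=1 \text{ for all } a,b\in G\rangle$; put $\mathcal{A}^0(G)=G$, $\mathcal{A}^{n+1}(G)=\mathcal{A}(\mathcal{A}^n(G))$, and let $i_G^n\colon G\to\mathcal{A}^n(G)$ be the composition of the canonical homomorphisms and $e\colon G\to\mathcal{A}^n(G)$ the trivial homomorphism. A homomorphism $\varphi\colon G\to H$ also denotes the chain map $\mathbb{Z}BG_*\to\mathbb{Z}BH_*\to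 C_*(BH)$ that it induces. A partial chain homotopy of dimension $n$ between chain maps $f,g\colon C_*\to D_*$ is a family of homomorphisms $P_m\colon C_m\to D_{m+1}$, $0\le m\le n$, with $\partial P_m+P_{m-1}\partial=f-g$ on $C_m$ for all $0\le m\le n$ (where $P_{-1}=0$). For based complexes the diameter of a chain $\sum_\alpha n_\alpha e_\alpha$ is $\sum_\alpha|n_\alpha|$, and $P$ is controlled by $\delta\colon\mathbb{N}\cup\{0\}\to\mathbb{N}\cup\{0\}$ if for all $i\le m\le n$ and all basis elements $\sigma$ of $C_i$ the diameter of $P_i(\sigma)$ is at most $\delta(m)$. Finally let $\gamma(0)=q(0)=0$ and, for $m\ge1$, \[ \gamma(m)=2^m(m+1)+\sum_{k=1}^{m-1}\gamma(k)\binom{m+1}{m-k},\qquad q(m)=2^m(m-1)+1+\sum_{k=1}^{m-1}q(k)\binom{m+1}{m-k}. \] Theorem 4.3. Let $c(m):=\gamma(m)-q(m)$. For every group $G$ and every integer $n\ge0$ there is a partial chain homotopy $\Phi_G^n$ of dimension $n$ between the chain maps \[ i_G^n,\ e\colon \mathbb{Z}BG_*\to C_*(B\mathcal{A}^n(G)) \]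 which is controlled by $c$. Here $c(m)\ge0$ for all $m\ge 0$; the values of $c(0),c(1),\dots,c(7)$ are $0, 3, 16, 97, 706, 6119, 61804, 713325$; and for every $m\ge1$ \[ c(m)=2\cdot2^m-1+\sum_{k=1}^{m-1}c(k)\binom{m+1}{m-k}. \] -/

import Mathlib

universe u

/-! ### Based chain complexes, diameters and partial chain homotopies -/

/-- A positive based chain complex over `ℤ`: in degree `n` it is the free abelian group on the
set `basis n`. -/
structure BasedChainComplex where
  basis : ℕ → Type u
  d : ∀ n, (basis (n + 1) →₀ ℤ) →ₗ[ℤ] (basis n →₀ ℤ)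
  d_comp_d : ∀ n, d n ∘ₗ d (n + 1) = 0

namespace BasedChainComplex

/-- The group of `n`-chains. -/
abbrev Chains (C : BasedChainComplex.{u}) (n : ℕ) : Type u := C.basis n →₀ ℤ

/-- Chain maps of based chain complexes (no compatibility with the bases is asked for). -/
structure ChainMap (C D : BasedChainComplex.{u}) where
  map : ∀ n, C.Chains n →ₗ[ℤ] D.Chains n
  comm : ∀ n, D.d n ∘ₗ map (n + 1) = map n ∘ₗ C.d n

/-- Composition of chain maps: first `f`, then `g`. -/
noncomputable def ChainMap.comp {C D E : BasedChainComplex.{u}} (g : ChainMap D E) (f : ChainMap C D) :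
    ChainMap C E where
  map n := g.map n ∘ₗ f.map n
  comm n := by
    rw [← LinearMap.comp_assoc, g.comm, LinearMap.comp_assoc, f.comm, LinearMap.comp_assoc]

/-- The diameter of a chain `∑ n_α e_α` is its `L¹`-norm `∑ |n_α|`. -/
def diameter {ι : Type*} (u : ι →₀ ℤ) : ℕ := u.sum fun _ a => a.natAbs

/-- A partial chain homotopy of dimension `n` between the chain maps `f` and `g`: homomorphisms
`P_m : C_m → D_{m+1}`, defined for `m ≤ n` only, such that `∂ P + P ∂ = f - g` on `C_m` for
every `m ≤ n`. -/
structure PartialChainHomotopy {C D : BasedChainComplex.{u}} (f g : ChainMap C D) (n : ℕ) where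
  map : ∀ m, m ≤ n → (C.Chains m →ₗ[ℤ] D.Chains (m + 1))
  comm_zero : D.d 0 ∘ₗ map 0 (Nat.zero_le n) = f.map 0 - g.map 0
  comm_succ : ∀ m (h : m + 1 ≤ n),
    D.d (m + 1) ∘ₗ map (m + 1) h + map m (Nat.le_of_succ_le h) ∘ₗ C.d m
      = f.map (m + 1) - g.map (m + 1)

/-- The diameter function `d_P(k) = max {d(P(c)) | c ∈ C_i a basis element, i ≤ k}` of a partial
chain homotopy of dimension `n`, defined for `k ≤ n`; a priori it may be infinite. -/
noncomputable def PartialChainHomotopy.diameterFunction {C D : BasedChainComplex.{u}}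
    {f g : ChainMap C D} {n : ℕ} (P : PartialChainHomotopy f g n) (k : ℕ) (hk : k ≤ n) : ℕ∞ :=
  ⨆ (i : ℕ) (hi : i ≤ k) (c : C.basis i),
    (diameter (P.map i (hi.trans hk) (Finsupp.single c 1)) : ℕ∞)

/-- `P` is controlled by `δ` if `d_P(k) ≤ δ(k)` wherever `d_P(k)` is defined. -/
def PartialChainHomotopy.ControlledBy {C D : BasedChainComplex.{u}}
    {f g : ChainMap C D} {n : ℕ} (P : PartialChainHomotopy f g n) (δ : ℕ → ℕ) : Prop :=
  ∀ k (hk : k ≤ n), P.diameterFunction k hk ≤ (δ k : ℕ∞)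

end BasedChainComplex

section SimplicialSets

open CategoryTheory Simplicial Opposite BasedChainComplex

/-! ### The Moore complex and the cellular chain complex of a simplicial set -/

/-- The boundary operator `∑ (-1)^i d_i` on the free abelian groups on the simplices of `X`. -/
noncomputable def mooreBoundary (X : SSet.{u}) (n : ℕ) :
    (X _⦋n + 1⦌ →₀ ℤ) →ₗ[ℤ] (X _⦋n⦌ →₀ ℤ) :=
  ∑ i : Fin (n + 2), (-1 : ℤ) ^ (i : ℕ) • Finsupp.lmapDomain ℤ ℤ (X.δ i)

theorem mooreBoundary_single (X : SSet.{u}) (n : ℕ) (x : X _⦋n + 1⦌) :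
    mooreBoundary X n (Finsupp.single x 1)
      = ∑ i : Fin (n + 2), (-1 : ℤ) ^ (i : ℕ) • Finsupp.single (X.δ i x) (1 : ℤ) := by
  simp only [mooreBoundary, LinearMap.sum_apply, LinearMap.smul_apply, Finsupp.lmapDomain_apply,
    Finsupp.mapDomain_single]

theorem mooreBoundary_comp (X : SSet.{u}) (n : ℕ) :
    mooreBoundary X n ∘ₗ mooreBoundary X (n + 1) = 0 := by
  let F : Type u ⥤ ModuleCat.{u} ℤ :=
    { obj := fun S => ModuleCat.of ℤ (S →₀ ℤ)
      map := fun f => ModuleCat.ofHom (Finsupp.lmapDomain ℤ ℤ f)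
      map_id := fun S => by
        ext : 1
        exact Finsupp.lmapDomain_id ℤ ℤ
      map_comp := fun f g => by
        ext : 1
        exact Finsupp.lmapDomain_comp ℤ ℤ f g }
  have hd : ∀ k, ((AlgebraicTopology.AlternatingFaceMapComplex.objD
      (((SimplicialObject.whiskering _ _).obj F).obj X) k).hom) = mooreBoundary X k := fun k => by
    simp only [AlgebraicTopology.AlternatingFaceMapComplex.objD, ModuleCat.hom_sum,
      ModuleCat.hom_smul]
    rfl
  have h := congrArg ModuleCat.Hom.hom (AlgebraicTopology.AlternatingFaceMapComplex.d_squared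
    (((SimplicialObject.whiskering _ _).obj F).obj X) n)
  rw [ModuleCat.hom_comp, hd, hd] at h
  exact h

/-- The Moore complex `ℤX_*` of a simplicial set `X`, with basis all simplices of `X`. -/
noncomputable def mooreComplex (X : SSet.{u}) : BasedChainComplex.{u} where
  basis n := X _⦋n⦌
  d n := mooreBoundary X n
  d_comp_d n := mooreBoundary_comp X n

/-- The chain map of Moore complexes induced by a map of simplicial sets. -/
noncomputable def mooreMap {X Y : SSet.{u}} (f : X ⟶ Y) :
    ChainMap (mooreComplex X) (mooreComplex Y) where
  map n := Finsupp.lmapDomain ℤ ℤ (f.app (op ⦋n⦌))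
  comm n := by
    refine Finsupp.lhom_ext' fun (x : X _⦋n + 1⦌) => LinearMap.ext_ring ?_
    have hx : ∀ i, f.app (op ⦋n⦌) (X.δ i x) = Y.δ i (f.app (op ⦋n + 1⦌) x) := fun i =>
      ConcreteCategory.congr_hom (f.naturality (SimplexCategory.δ i).op) x
    have h1 : mooreBoundary Y n (Finsupp.lmapDomain ℤ ℤ (f.app (op ⦋n + 1⦌)) (Finsupp.single x 1))
        = Finsupp.lmapDomain ℤ ℤ (f.app (op ⦋n⦌)) (mooreBoundary X n (Finsupp.single x 1)) := by
      rw [Finsupp.lmapDomain_apply, Finsupp.mapDomain_single, mooreBoundary_single,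
        mooreBoundary_single]
      simp only [map_sum, map_smul, Finsupp.lmapDomain_apply, Finsupp.mapDomain_single, hx]
    exact h1

/-- The projection from all chains to the free abelian group on the nondegenerate simplices, which
kills the degenerate simplices. -/
noncomputable def nondegProj (X : SSet.{u}) (n : ℕ) :
    (X _⦋n⦌ →₀ ℤ) →ₗ[ℤ] (X.nonDegenerate n →₀ ℤ) :=
  Finsupp.lsubtypeDomain (X.nonDegenerate n)



theorem nondegProj_single_of_mem (X : SSet.{u}) (n : ℕ) (x : X _⦋n⦌) (hx : x ∈ X.degenerate n)
    (a : ℤ) : nondegProj X n (Finsupp.single x a) = 0 := by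
  classical
  ext ⟨y, hy⟩
  have hne : x ≠ y := fun h => hy (h ▸ hx)
  change Finsupp.single x a y = 0
  rw [Finsupp.single_apply, if_neg hne]

theorem nondegProj_single (X : SSet.{u}) (n : ℕ) (x : X.nonDegenerate n) (a : ℤ) :
    nondegProj X n (Finsupp.single x.1 a) = Finsupp.single x a := by
  classical
  ext y
  change Finsupp.single x.1 a y.1 = _
  simp only [Finsupp.single_apply, Subtype.ext_iff]

/-- The kernel of the projection is the subgroup `D_n(X)` generated by the degenerate simplices. -/
theorem ker_nondegProj (X : SSet.{u}) (n : ℕ) :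
    LinearMap.ker (nondegProj X n)
      = Submodule.span ℤ ((fun x => Finsupp.single x (1 : ℤ)) '' X.degenerate n) := by
  rw [← Finsupp.supported_eq_span_single]
  ext c
  rw [LinearMap.mem_ker, Finsupp.mem_supported]
  constructor
  · intro h x hx
    by_contra hd
    have := DFunLike.congr_fun h (⟨x, hd⟩ : X.nonDegenerate n)
    exact (Finsupp.mem_support_iff.1 hx) this
  · intro h
    ext ⟨y, hy⟩
    change c y = 0
    by_contra hc
    exact hy (h (Finsupp.mem_support_iff.2 hc))

/-- The degenerate simplices span a subcomplex of the Moore complex. -/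
theorem nondegProj_boundary_of_degenerate (X : SSet.{u}) (n : ℕ) (x : X _⦋n + 1⦌)
    (hx : x ∈ X.degenerate (n + 1)) :
    nondegProj X n (mooreBoundary X n (Finsupp.single x 1)) = 0 := by
  rw [SSet.degenerate_eq_iUnion_range_σ] at hx
  obtain ⟨j, y, rfl⟩ := Set.mem_iUnion.1 hx
  rw [mooreBoundary_single, map_sum]
  have hne : j.castSucc ≠ j.succ := (Fin.castSucc_lt_succ).ne
  rw [Finset.sum_eq_add (Fin.castSucc j) j.succ hne]
  · simp [SSet.δ_comp_σ_self_apply, SSet.δ_comp_σ_succ_apply, pow_succ]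
  · intro i _ hi
    rw [map_smul, nondegProj_single_of_mem, smul_zero]
    cases n with
    | zero =>
      exfalso
      fin_cases j
      fin_cases i <;> simp_all
    | succ n =>
      rcases lt_or_gt_of_ne hi.1 with h | h
      · obtain ⟨j, rfl⟩ := Fin.exists_succ_eq.2 (show j ≠ 0 by rintro rfl; simp at h)
        obtain ⟨i, rfl⟩ := Fin.exists_castSucc_eq.2 (show i ≠ Fin.last _ by
          rintro rfl; exact absurd h (Fin.le_last _).not_gt)
        have := X.δ_comp_σ_of_le_apply (i := i) (j := j) (by
          simp [Fin.lt_def, Fin.le_def] at h ⊢; omega) y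
        rw [this]
        exact X.σ_mem_degenerate _ _
      · have h2 : j.succ < i := lt_of_le_of_ne (by
          simp [Fin.lt_def, Fin.le_def] at h ⊢; omega) hi.2.symm
        rw [X.δ_comp_σ_of_gt'_apply h2]
        exact X.σ_mem_degenerate _ _
  · simp
  · simp

theorem nondegProj_boundary (X : SSet.{u}) (n : ℕ) (c : X _⦋n + 1⦌ →₀ ℤ)
    (hc : nondegProj X (n + 1) c = 0) : nondegProj X n (mooreBoundary X n c) = 0 := by
  have hc' := (ker_nondegProj X (n + 1)).le (LinearMap.mem_ker.2 hc)
  rw [← LinearMap.comp_apply, ← LinearMap.mem_ker]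
  refine Submodule.span_le.2 ?_ hc'
  rintro _ ⟨x, hx, rfl⟩
  exact nondegProj_boundary_of_degenerate X n x hx

/-- The cellular boundary operator: the boundary in the Moore complex, followed by the projection
which discards degenerate faces. -/
noncomputable def cellularBoundary (X : SSet.{u}) (n : ℕ) :
    (X.nonDegenerate (n + 1) →₀ ℤ) →ₗ[ℤ] (X.nonDegenerate n →₀ ℤ) :=
  nondegProj X n ∘ₗ mooreBoundary X n ∘ₗ Finsupp.lmapDomain ℤ ℤ Subtype.val

theorem cellularBoundary_comp_nondegProj (X : SSet.{u}) (n : ℕ) :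
    cellularBoundary X n ∘ₗ nondegProj X (n + 1) = nondegProj X n ∘ₗ mooreBoundary X n := by
  refine LinearMap.ext fun c => sub_eq_zero.1 ?_
  change nondegProj X n (mooreBoundary X n (Finsupp.lmapDomain ℤ ℤ Subtype.val
    (nondegProj X (n + 1) c))) - nondegProj X n (mooreBoundary X n c) = 0
  rw [← map_sub, ← map_sub]
  refine nondegProj_boundary X n _ ?_
  rw [map_sub, sub_eq_zero]
  ext y
  change Finsupp.mapDomain Subtype.val _ y.1 = _
  rw [Finsupp.mapDomain_apply Subtype.val_injective]

theorem nondegProj_surjective (X : SSet.{u}) (n : ℕ) : Function.Surjective (nondegProj X n) := by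
  intro c
  refine ⟨Finsupp.mapDomain Subtype.val c, ?_⟩
  ext y
  change Finsupp.mapDomain Subtype.val _ y.1 = _
  rw [Finsupp.mapDomain_apply Subtype.val_injective]

/-- The cellular chain complex `C_*(X) = C_*(|X|)` of (the geometric realization of) a simplicial
set `X`. The cells of `|X|` are the nondegenerate simplices of `X`, so these form the basis; as a
complex it is the quotient `ℤX_* / D_*(X)` of the Moore complex by the degenerate simplices. -/
noncomputable def cellularComplex (X : SSet.{u}) : BasedChainComplex.{u} where
  basis n := X.nonDegenerate n
  d n := cellularBoundary X n
  d_comp_d n := by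
    refine LinearMap.ext fun c => ?_
    obtain ⟨c, rfl⟩ := nondegProj_surjective X _ c
    have h1 := fun k x => LinearMap.congr_fun (cellularBoundary_comp_nondegProj X k) x
    have h2 := LinearMap.congr_fun (mooreBoundary_comp X n) c
    simp only [LinearMap.comp_apply] at h1 h2 ⊢
    rw [h1, h1, h2, LinearMap.zero_apply, map_zero, LinearMap.zero_apply]

/-- The projection `p : ℤX_* → C_*(X)`. -/
noncomputable def cellularProj (X : SSet.{u}) : ChainMap (mooreComplex X) (cellularComplex X) where
  map n := nondegProj X n
  comm n := cellularBoundary_comp_nondegProj X n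

/-! ### The simplicial classifying space of a group -/

theorem partialProd_inv_mul {G : Type*} [Group G] {n m : ℕ} (g : Fin n → G)
    (f : Fin (m + 1) → Fin (n + 1)) (j : Fin (m + 1)) :
    Fin.partialProd (fun i : Fin m => (Fin.partialProd g (f i.castSucc))⁻¹
      * Fin.partialProd g (f i.succ)) j
      = (Fin.partialProd g (f 0))⁻¹ * Fin.partialProd g (f j) := by
  induction j using Fin.induction with
  | zero => simp
  | succ j ih => rw [Fin.partialProd_succ, ih]; group

/-- The simplicial classifying space `BG`. Its `n`-simplices are the tuples `[g_1, …, g_n]`.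
For `f : [m] → [n]`, the `i`-th component of `f^*[g_1, …, g_n]` is the product
`g_{f(i-1)+1} ⋯ g_{f(i)}`, written here as `(g_1 ⋯ g_{f(i-1)})⁻¹ (g_1 ⋯ g_{f(i)})`. The resulting
faces and degeneracies are computed below. -/
def classifyingSSet (G : Type u) [Group G] : SSet.{u} where
  obj n := Fin n.unop.len → G
  map f := ↾fun g i => (Fin.partialProd g (f.unop.toOrderHom i.castSucc))⁻¹
    * Fin.partialProd g (f.unop.toOrderHom i.succ)
  map_id n := by
    ext g i
    exact Fin.partialProd_right_inv g i
  map_comp f f' := by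
    ext g i
    refine Eq.symm (Eq.trans (congrArg₂ (fun a b => a⁻¹ * b)
      (partialProd_inv_mul g _ _) (partialProd_inv_mul g _ _)) ?_)
    rw [mul_inv_rev, mul_assoc, inv_inv, mul_inv_cancel_left]
    rfl

section classifyingSSet

variable {G : Type u} [Group G]

/-- An `n`-tuple of group elements, as an `n`-simplex of `BG`. -/
def barSimplex {n : ℕ} (g : Fin n → G) : (classifyingSSet G) _⦋n⦌ := g

/-- `d_0 [g_1, …, g_{n+1}] = [g_2, …, g_{n+1}]`. -/
theorem classifyingSSet_δ_zero {n : ℕ} (g : Fin (n + 1) → G) :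
    (classifyingSSet G).δ 0 (barSimplex g) = barSimplex (Fin.tail g) := by
  funext k
  change (Fin.partialProd g ((0 : Fin (n + 2)).succAbove k.castSucc))⁻¹
    * Fin.partialProd g ((0 : Fin (n + 2)).succAbove k.succ) = g k.succ
  rw [Fin.succAbove_zero]
  exact Fin.partialProd_right_inv g k.succ

/-- `d_i [g_1, …, g_{n+1}] = [g_1, …, g_i g_{i+1}, …, g_{n+1}]` for `1 ≤ i ≤ n` and
`d_{n+1} [g_1, …, g_{n+1}] = [g_1, …, g_n]`. -/
theorem classifyingSSet_δ_succ {n : ℕ} (i : Fin (n + 1)) (g : Fin (n + 1) → G) :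
    (classifyingSSet G).δ i.succ (barSimplex g) = barSimplex (Fin.contractNth i (· * ·) g) := by
  funext k
  change (Fin.partialProd g (i.succ.succAbove k.castSucc))⁻¹
    * Fin.partialProd g (i.succ.succAbove k.succ) = Fin.contractNth i (· * ·) g k
  have h := Fin.partialProd_right_inv (Fin.contractNth i (· * ·) g) k
  rw [Fin.partialProd_contractNth] at h
  exact h

/-- `s_i [g_1, …, g_n] = [g_1, …, g_i, e, g_{i+1}, …, g_n]`. -/
theorem classifyingSSet_σ {n : ℕ} (i : Fin (n + 1)) (g : Fin n → G) :
    (classifyingSSet G).σ i (barSimplex g) = barSimplex (i.insertNth (α := fun _ => G) 1 g) := by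
  funext k
  change (Fin.partialProd g (i.predAbove k.castSucc))⁻¹
    * Fin.partialProd g (i.predAbove k.succ) = i.insertNth (α := fun _ => G) 1 g k
  refine i.succAboveCases ?_ (fun j => ?_) k
  · rw [Fin.insertNth_apply_same, Fin.predAbove_castSucc_self, Fin.predAbove_succ_self,
      inv_mul_cancel]
  · rw [Fin.insertNth_apply_succAbove]
    rw [← Fin.partialProd_right_inv g j]
    congr 3
    · rcases lt_or_ge j.castSucc i with h | h
      · rw [Fin.succAbove_of_castSucc_lt i j h, Fin.predAbove_castSucc_of_le i _ h.le]
      · rw [Fin.succAbove_of_le_castSucc i j h, ← Fin.succ_castSucc,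
          Fin.predAbove_succ_of_le i _ h]
    · rcases lt_or_ge j.castSucc i with h | h
      · rw [Fin.succAbove_of_castSucc_lt i j h, Fin.succ_castSucc,
          Fin.predAbove_castSucc_of_le i _ (Fin.castSucc_lt_iff_succ_le.1 h)]
      · rw [Fin.succAbove_of_le_castSucc i j h, Fin.predAbove_succ_of_le i _
          (h.trans j.castSucc_lt_succ.le)]

/-- A simplex `[g_1, …, g_n]` is degenerate exactly if some `g_i` is trivial. -/
theorem barSimplex_mem_degenerate_iff {n : ℕ} (g : Fin n → G) :
    barSimplex g ∈ (classifyingSSet G).degenerate n ↔ ∃ i, g i = 1 := by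
  cases n with
  | zero => simp
  | succ n =>
    rw [SSet.degenerate_eq_iUnion_range_σ, Set.mem_iUnion]
    constructor
    · rintro ⟨i, y, hy⟩
      refine ⟨i, ?_⟩
      have h := congrFun (hy.symm.trans (classifyingSSet_σ i y)) i
      exact h.trans (Fin.insertNth_apply_same (α := fun _ => G) i 1 y)
    · rintro ⟨i, hi⟩
      refine ⟨i, barSimplex (i.removeNth g), ?_⟩
      rw [classifyingSSet_σ, ← hi, Fin.insertNth_self_removeNth]

end classifyingSSet

theorem map_partialProd {G H : Type*} [Group G] [Group H] (φ : G →* H) {n : ℕ} (g : Fin n → G)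
    (j : Fin (n + 1)) : φ (Fin.partialProd g j) = Fin.partialProd (fun i => φ (g i)) j := by
  induction j using Fin.induction with
  | zero => simp
  | succ j ih => rw [Fin.partialProd_succ, Fin.partialProd_succ, map_mul, ih]

/-- The map of simplicial sets `BG → BH`, `[g_1, …, g_n] ↦ [φ(g_1), …, φ(g_n)]`, induced by a
group homomorphism `φ`. -/
def classifyingMap {G H : Type u} [Group G] [Group H] (φ : G →* H) :
    classifyingSSet G ⟶ classifyingSSet H where
  app n := ↾fun g i => φ (g i)
  naturality n m f := by
    ext g
    funext i
    refine (map_mul φ _ _).trans ?_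
    rw [map_inv]
    exact congrArg₂ (fun a b : H => a⁻¹ * b) (map_partialProd φ g _) (map_partialProd φ g _)

/-- The Moore complex `ℤBG_*`. -/
noncomputable abbrev mooreB (G : Type u) [Group G] : BasedChainComplex.{u} :=
  mooreComplex (classifyingSSet G)

/-- The cellular chain complex `C_*(BG)`. -/
noncomputable abbrev cellularB (G : Type u) [Group G] : BasedChainComplex.{u} :=
  cellularComplex (classifyingSSet G)

/-- The chain map `ℤBG_* → C_*(BH)` induced by a group homomorphism `φ : G → H`: the induced map
`ℤBG_* → ℤBH_*` followed by the projection `ℤBH_* → C_*(BH)`. -/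
noncomputable def inducedChainMap {G H : Type u} [Group G] [Group H] (φ : G →* H) :
    ChainMap (mooreB G) (cellularB H) :=
  (cellularProj (classifyingSSet H)).comp (mooreMap (classifyingMap φ))

end SimplicialSets

/-! ### Mitosis groups -/

/-- The element of the free product `G * F(u, t)` given by the letter `u`. -/
def mitosisU (G : Type u) [Group G] : Monoid.Coprod G (FreeGroup Bool) :=
  Monoid.Coprod.inr (FreeGroup.of false)

/-- The element of the free product `G * F(u, t)` given by the letter `t`. -/
def mitosisT (G : Type u) [Group G] : Monoid.Coprod G (FreeGroup Bool) :=
  Monoid.Coprod.inr (FreeGroup.of true)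

/-- The relators of the mitosis group, for all `a, b ∈ G`: `a^t = a · a^u` and `[a^u, b] = 1`,
where `x^y = y x y⁻¹` and `[x, y] = x y x⁻¹ y⁻¹`. -/
def mitosisRelators (G : Type u) [Group G] : Set (Monoid.Coprod G (FreeGroup Bool)) :=
  {r | ∃ a : G, r = (mitosisT G * Monoid.Coprod.inl a * (mitosisT G)⁻¹) *
      (Monoid.Coprod.inl a * (mitosisU G * Monoid.Coprod.inl a * (mitosisU G)⁻¹))⁻¹} ∪
  {r | ∃ a b : G, r = (mitosisU G * Monoid.Coprod.inl a * (mitosisU G)⁻¹) * Monoid.Coprod.inl b *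
      (mitosisU G * Monoid.Coprod.inl a * (mitosisU G)⁻¹)⁻¹ * (Monoid.Coprod.inl b)⁻¹}

/-- The mitosis `𝒜(G) = ⟨G, u, t | a^t = a · a^u, [a^u, b] = 1 for all a, b ∈ G⟩`. -/
def Mitosis (G : Type u) [Group G] : Type u :=
  Monoid.Coprod G (FreeGroup Bool) ⧸ Subgroup.normalClosure (mitosisRelators G)

instance (G : Type u) [Group G] : Group (Mitosis G) :=
  inferInstanceAs (Group (_ ⧸ Subgroup.normalClosure (mitosisRelators G)))

/-- The canonical homomorphism `k_G : G → 𝒜(G)`. -/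
def Mitosis.of (G : Type u) [Group G] : G →* Mitosis G :=
  (QuotientGroup.mk' (Subgroup.normalClosure (mitosisRelators G))).comp Monoid.Coprod.inl

/-- The `n`-th mitosis `𝒜ⁿ(G)`: `𝒜⁰(G) = G` and `𝒜ⁿ⁺¹(G) = 𝒜(𝒜ⁿ(G))`. -/
def mitosisPow (G : Type u) [Group G] : ℕ → GrpCat.{u}
  | 0 => GrpCat.of G
  | n + 1 => GrpCat.of (Mitosis (mitosisPow G n))

/-- The `n`-th mitosis embedding `i_Gⁿ : G → 𝒜ⁿ(G)`, the composition
`G → 𝒜(G) → 𝒜²(G) → ⋯ → 𝒜ⁿ(G)` of the canonical homomorphisms. -/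
def mitosisEmb (G : Type u) [Group G] : (n : ℕ) → G →* mitosisPow G n
  | 0 => MonoidHom.id G
  | n + 1 => (Mitosis.of (mitosisPow G n)).comp (mitosisEmb G n)

/-! ### The control functions -/

/-- `γ(0) = 0` and `γ(m) = 2^m (m+1) + ∑_{k=1}^{m-1} γ(k) C(m+1, m-k)` for `m ≥ 1`. -/
def gammaFun (m : ℕ) : ℕ :=
  if m = 0 then 0 else
    2 ^ m * (m + 1) +
      ∑ k ∈ (Finset.Icc 1 (m - 1)).attach, gammaFun k.1 * (m + 1).choose (m - k.1)
termination_by m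
decreasing_by have := Finset.mem_Icc.1 k.2; omega

/-- `q(0) = 0` and `q(m) = 2^m (m-1) + 1 + ∑_{k=1}^{m-1} q(k) C(m+1, m-k)` for `m ≥ 1`. -/
def qFun (m : ℕ) : ℕ :=
  if m = 0 then 0 else
    2 ^ m * (m - 1) + 1 +
      ∑ k ∈ (Finset.Icc 1 (m - 1)).attach, qFun k.1 * (m + 1).choose (m - k.1)
termination_by m
decreasing_by have := Finset.mem_Icc.1 k.2; omega

theorem gammaFun_zero : gammaFun 0 = 0 := by
  rw [gammaFun, if_pos rfl]

theorem gammaFun_rec {m : ℕ} (hm : 1 ≤ m) :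
    gammaFun m = 2 ^ m * (m + 1)
      + ∑ k ∈ Finset.Icc 1 (m - 1), gammaFun k * (m + 1).choose (m - k) := by
  rw [gammaFun, if_neg (by omega),
    Finset.sum_attach _ fun k => gammaFun k * (m + 1).choose (m - k)]

theorem qFun_zero : qFun 0 = 0 := by
  rw [qFun, if_pos rfl]

theorem qFun_rec {m : ℕ} (hm : 1 ≤ m) :
    qFun m = 2 ^ m * (m - 1) + 1
      + ∑ k ∈ Finset.Icc 1 (m - 1), qFun k * (m + 1).choose (m - k) := by
  rw [qFun, if_neg (by omega), Finset.sum_attach _ fun k => qFun k * (m + 1).choose (m - k)]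

/-- `c(m) = γ(m) - q(m)`, as a subtraction of natural numbers (truncated only if `γ(m) < q(m)`). -/
def cFun (m : ℕ) : ℕ := gammaFun m - qFun m

/-! The homotopy is built equivariantly, on chains of homogeneous simplices (lists of vertices in
the group), and passes to the bar complex by dividing out left translations and degenerate lists
(`barRelations`). There every geometric operation is an explicit recursion on lists, and its
boundary formula is an induction with the cone operator.

The inductive step uses both relations of the mitosis. Let `f : G →* K` have a null homotopy `P`,
and let `j : K →* K'` and `u`, `t` satisfy the mitosis relations; write a for `j (f a)` and a^u, a^t
for its conjugates. As a^u commutes with the image of `j`, the product (a, b) ↦ a · b^u respects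
translation in both variables, so shuffle products of bar chains make sense in `K'`. Three
homotopies are combined in `mitosisHomotopy`. A prism joins a^u to a^t = a · a^u, because
conjugation is invisible in the bar complex up to a prism. The Eilenberg–Mac Lane homotopy joins the
diagonal a · a^u to the sum over all cuts of front face times back face (Alexander–Whitney, then
shuffle). Finally, `P` applied to the front faces contracts every summand whose back face has
positive dimension; the constant fronts are degenerate except for a single vertex, which leaves a^u.
Subtracting the second and third homotopies from the first cancels the diagonal, a^u and all mixed
products. Only the summand with back face a vertex survives: it is `j ∘ f`. The trivial map vanishes
in positive dimensions after normalization.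

In the third homotopy the front face has smaller dimension than the simplex, so a homotopy of
dimension n yields one of dimension n + 1 (`IsNullHomotopy.mitosis`).

On an m-simplex, m ≥ 1, the prism has m + 1 terms and the Eilenberg–Mac Lane homotopy at most
2^(m+1) - (m+2) nondegenerate ones, together 2 · 2^m - 1. Multiplying a (k+1)-chain of diameter c(k)
by an (m-k)-simplex costs a factor C(m+1, m-k). This is exactly the recursion of c. -/

/-- Chains on the free simplices with vertices in `α`: the simplices are the lists of vertices, and
the empty list spans the augmentation. -/
abbrev VertexChain (α : Type*) := List α →₀ ℤ

/-! ### Augmented chains on lists of vertices: cones, signs and boundary. -/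

namespace VertexChain

variable {α β γ α' β' γ' M N : Type*} [AddCommGroup M] [AddCommGroup N]

/-- The chain given by one list of vertices. -/
noncomputable def of (l : List α) : VertexChain α := Finsupp.single l 1

/-- The linear extension of a function on lists of vertices. -/
noncomputable def lift (f : List α → M) : VertexChain α →ₗ[ℤ] M := Finsupp.linearCombination ℤ f

@[simp] theorem lift_of (f : List α → M) (l : List α) : lift f (of l) = f l := by
  simp [lift, of]

theorem hom_ext {f g : VertexChain α →ₗ[ℤ] M} (h : ∀ l, f (of l) = g (of l)) : f = g :=
  Finsupp.lhom_ext' fun l => LinearMap.ext_ring (h l)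

theorem hom_congr {f g : VertexChain α →ₗ[ℤ] M} (h : ∀ l, f (of l) = g (of l))
    (x : VertexChain α) : f x = g x := by
  rw [hom_ext h]

/-- The map of chains induced by a map of vertices. -/
noncomputable def push (f : α → β) : VertexChain α →ₗ[ℤ] VertexChain β :=
  lift fun l => of (l.map f)

@[simp] theorem push_of (f : α → β) (l : List α) : push f (of l) = of (l.map f) := lift_of _ _

/-- The cone with vertex `a`. -/
noncomputable def cons (a : α) : VertexChain α →ₗ[ℤ] VertexChain α := lift fun l => of (a :: l)

@[simp] theorem cons_of (a : α) (l : List α) : cons a (of l) = of (a :: l) := lift_of _ _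

theorem push_cons (f : α → β) (a : α) (x : VertexChain α) :
    push f (cons a x) = cons (f a) (push f x) :=
  hom_congr (f := push f ∘ₗ cons a) (g := cons (f a) ∘ₗ push f) (by simp) x

/-- The sign `(-1) ^ length`. -/
noncomputable def sgn : VertexChain α →ₗ[ℤ] VertexChain α :=
  lift fun l => (-1 : ℤ) ^ l.length • of l

@[simp] theorem sgn_of (l : List α) : sgn (of l) = (-1 : ℤ) ^ l.length • of l := lift_of _ _

theorem sgn_cons (a : α) (x : VertexChain α) : sgn (cons a x) = -cons a (sgn x) :=
  hom_congr (f := sgn ∘ₗ cons a) (g := -(cons a ∘ₗ sgn)) (by simp [pow_succ]) x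

/-- The boundary of a list of vertices. -/
noncomputable def boundaryList : List α → VertexChain α
  | [] => 0
  | a :: l => of l - cons a (boundaryList l)

/-- The alternating sum of the deletions of a vertex. -/
noncomputable def boundary : VertexChain α →ₗ[ℤ] VertexChain α := lift boundaryList

@[simp] theorem boundary_nil : boundary (of ([] : List α)) = 0 := by
  simp [boundary, boundaryList]

theorem boundary_of_cons (a : α) (l : List α) :
    boundary (of (a :: l)) = of l - cons a (boundary (of l)) := by
  simp [boundary, boundaryList]

theorem boundary_cons (a : α) (x : VertexChain α) :
    boundary (cons a x) = x - cons a (boundary x) :=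
  hom_congr (f := boundary ∘ₗ cons a) (g := LinearMap.id - cons a ∘ₗ boundary)
    (by simp [boundary_of_cons]) x

theorem sgn_boundary (x : VertexChain α) : sgn (boundary x) = -boundary (sgn x) := by
  refine hom_congr (f := sgn ∘ₗ boundary) (g := -(boundary ∘ₗ sgn)) (fun l => ?_) x
  induction l with
  | nil => simp
  | cons a l ih =>
    simp only [LinearMap.comp_apply, LinearMap.neg_apply] at ih ⊢
    rw [← cons_of, boundary_cons, sgn_cons, map_neg, boundary_cons, map_sub, sgn_cons, ih, map_neg]
    abel

theorem push_boundary (f : α → β) (x : VertexChain α) :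
    push f (boundary x) = boundary (push f x) := by
  refine hom_congr (f := push f ∘ₗ boundary) (g := boundary ∘ₗ push f) (fun l => ?_) x
  induction l with
  | nil => simp
  | cons a l ih =>
    simp only [LinearMap.comp_apply] at ih ⊢
    rw [← cons_of, boundary_cons, push_cons, boundary_cons, map_sub, push_cons, ih]

theorem boundary_of_eq_sum (l : List α) :
    boundary (of l) = ∑ i ∈ Finset.range l.length, (-1 : ℤ) ^ i • of (l.eraseIdx i) := by
  induction l with
  | nil => simp
  | cons a l ih =>
    rw [boundary_of_cons, ih, List.length_cons, Finset.sum_range_succ']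
    simp [pow_succ, map_sum, sub_eq_neg_add]

/-! ### Prisms -/

/-- The prism on a list of vertices, with bottom given by `f` and top given by `g`. -/
noncomputable def prismList (f g : α → β) : List α → VertexChain β
  | [] => 0
  | a :: l => of (f a :: g a :: l.map g) - cons (f a) (prismList f g l)

/-- The prism operator between the chain maps induced by two maps of vertices. -/
noncomputable def prism (f g : α → β) : VertexChain α →ₗ[ℤ] VertexChain β := lift (prismList f g)

@[simp] theorem prism_nil (f g : α → β) : prism f g (of []) = 0 := lift_of _ _

theorem prism_cons (f g : α → β) (a : α) (x : VertexChain α) :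
    prism f g (cons a x) = cons (f a) (cons (g a) (push g x)) - cons (f a) (prism f g x) :=
  hom_congr (f := prism f g ∘ₗ cons a)
    (g := cons (f a) ∘ₗ cons (g a) ∘ₗ push g - cons (f a) ∘ₗ prism f g)
    (by simp [prism, prismList]) x

theorem boundary_prism (f g : α → β) (x : VertexChain α) :
    boundary (prism f g x) + prism f g (boundary x) = push g x - push f x := by
  refine hom_congr (f := boundary ∘ₗ prism f g + prism f g ∘ₗ boundary) (g := push g - push f)
    (fun l => ?_) x
  induction l with
  | nil => simp
  | cons a l ih =>
    simp only [LinearMap.comp_apply, LinearMap.add_apply, LinearMap.sub_apply] at ih ⊢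
    have ih' := congrArg (cons (f a)) ih
    rw [← cons_of]
    simp only [prism_cons, boundary_cons, push_cons, map_sub, map_add, push_boundary] at ih' ⊢
    rw [← eq_sub_iff_add_eq] at ih'
    rw [ih']
    abel

theorem push_prism (θ : β → γ) (f g : α → β) (l : List α) :
    push θ (prism f g (of l)) = prism (θ ∘ f) (θ ∘ g) (of l) := by
  induction l with
  | nil => simp
  | cons a l ih => rw [← cons_of, prism_cons, prism_cons]; simp [push_cons, ih]

theorem prism_push (f g : β → γ) (θ : α → β) (l : List α) :
    prism f g (of (l.map θ)) = prism (f ∘ θ) (g ∘ θ) (of l) := by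
  induction l with
  | nil => simp
  | cons a l ih =>
    rw [List.map_cons, ← cons_of, prism_cons, ← cons_of, prism_cons]; simp [ih]

/-! ### Shuffles -/

/-- The signed sum of the lattice paths through two lists of vertices. -/
noncomputable def shuffleList (μ : α → β → γ) : List α → List β → VertexChain γ
  | [], [] => 0
  -- Exhausting the first list is accepted only at the last vertex of the second, and exhausting the
  -- second never, so that each path to the end is counted once.
  | [], [_] => of []
  | [], _ :: _ :: _ => 0
  | _ :: _, [] => 0
  | a :: l, b :: m => cons (μ a b)
      (shuffleList μ l (b :: m) + (-1 : ℤ) ^ l.length • shuffleList μ (a :: l) m)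
termination_by l m => l.length + m.length

/-- The Eilenberg–Zilber shuffle product, followed by a map `μ` on pairs of vertices. -/
noncomputable def shuffle (μ : α → β → γ) :
    VertexChain α →ₗ[ℤ] VertexChain β →ₗ[ℤ] VertexChain γ :=
  lift fun l => lift fun m => shuffleList μ l m

theorem shuffle_of (μ : α → β → γ) (l : List α) (m : List β) :
    shuffle μ (of l) (of m) = shuffleList μ l m := by simp [shuffle]

theorem hom_congr₂ {f g : VertexChain α →ₗ[ℤ] VertexChain β →ₗ[ℤ] M}
    (h : ∀ l m, f (of l) (of m) = g (of l) (of m)) (x : VertexChain α) (y : VertexChain β) :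
    f x y = g x y := by
  rw [hom_ext fun l => hom_ext (h l)]

@[simp] theorem shuffle_nil_right (μ : α → β → γ) (x : VertexChain α) :
    shuffle μ x (of []) = 0 := by
  refine hom_congr (f := (shuffle μ).flip (of [])) (g := 0) (fun l => ?_) x
  cases l <;> simp [shuffle_of, shuffleList]

theorem shuffle_cons_cons (μ : α → β → γ) (a : α) (b : β) (x : VertexChain α)
    (y : VertexChain β) : shuffle μ (cons a x) (cons b y)
      = cons (μ a b) (shuffle μ x (cons b y) + shuffle μ (cons a (sgn x)) y) := by
  refine hom_congr₂ (f := (shuffle μ).compl₁₂ (cons a) (cons b))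
    (g := ((shuffle μ).compl₂ (cons b) + (shuffle μ) ∘ₗ cons a ∘ₗ sgn).compr₂ (cons (μ a b)))
    (fun l m => ?_) x y
  simp [shuffle_of, shuffleList]

/-- With the empty list on the left, the shuffle is the augmentation of the right factor. -/
theorem shuffle_nil_boundary (μ : α → β → γ) (y : VertexChain β) :
    shuffle μ (of []) (boundary y) = 0 := by
  refine hom_congr (f := shuffle μ (of []) ∘ₗ boundary) (g := 0) (fun l => ?_) y
  rcases l with _ | ⟨a, _ | ⟨b, _ | ⟨c, l⟩⟩⟩
  · simp
  · simp [boundary_of_cons]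
  · simp [boundary_of_cons, shuffle_of, shuffleList]
  · have h (x : VertexChain β) : shuffle μ (of []) (cons a (cons b x)) = 0 :=
      hom_congr (f := shuffle μ (of []) ∘ₗ cons a ∘ₗ cons b) (g := 0)
        (by simp [shuffle_of, shuffleList]) x
    have h' : shuffle μ (of []) (of (b :: c :: l)) = 0 := by simp [shuffle_of, shuffleList]
    have h'' : shuffle μ (of []) (of (a :: c :: l)) = 0 := by simp [shuffle_of, shuffleList]
    rw [LinearMap.comp_apply, boundary_of_cons, boundary_of_cons, map_sub, map_sub, map_sub, h, h',
      cons_of, h'', sub_zero, sub_zero, LinearMap.zero_apply]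

theorem shuffle_nil_left_boundary (μ : α → β → γ) (y : List β) :
    boundary (shuffle μ (of []) (of y)) = 0 := by
  rcases y with _ | ⟨a, _ | ⟨b, l⟩⟩ <;> simp [shuffle_of, shuffleList]

/-- This is the Leibniz rule: `sgn` counts vertices instead of dimension, hence the minus sign. It
holds in the augmented complexes because of the end conventions of `shuffleList`. -/
theorem boundary_shuffle (μ : α → β → γ) (x : VertexChain α) (y : VertexChain β) :
    boundary (shuffle μ x y) = shuffle μ (boundary x) y - shuffle μ (sgn x) (boundary y) := by
  refine hom_congr₂ (f := (shuffle μ).compr₂ boundary)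
    (g := shuffle μ ∘ₗ boundary - (shuffle μ).compl₁₂ sgn boundary) (fun l m => ?_) x y
  induction hn : l.length + m.length using Nat.strong_induction_on generalizing l m with
  | _ n ih =>
  subst hn
  simp only [LinearMap.compr₂_apply, LinearMap.sub_apply, LinearMap.comp_apply,
    LinearMap.compl₁₂_apply] at ih ⊢
  rcases l with _ | ⟨a, l⟩
  · simp [shuffle_nil_left_boundary, shuffle_nil_boundary]
  rcases m with _ | ⟨b, m⟩
  · simp
  have h1 := congrArg (cons (μ a b)) (ih _ (by simp) l (b :: m) rfl)
  have h2 := congrArg (cons (μ a b)) (ih _ (by simp) (a :: l) m rfl)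
  have h2' := congrArg (fun x => (-1 : ℤ) ^ l.length • x) h2
  have hs : (-1 : ℤ) ^ l.length * (-1 : ℤ) ^ l.length = 1 := by
    rw [← mul_pow]; simp
  rw [← cons_of, ← cons_of] at *
  simp only [boundary_cons, shuffle_cons_cons, map_sub, map_add, sgn_cons, LinearMap.sub_apply,
    LinearMap.neg_apply, map_neg, sgn_of, map_smul, LinearMap.smul_apply, sgn_boundary,
    smul_sub, smul_neg, smul_smul, hs, one_smul] at h1 h2' ⊢
  rw [h1, h2']
  simp only [smul_add, smul_smul, hs, one_smul]
  abel

theorem push_shuffle (θ : γ → γ') (μ : α → β → γ) (x : VertexChain α) (y : VertexChain β) :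
    push θ (shuffle μ x y) = shuffle (fun a b => θ (μ a b)) x y := by
  refine hom_congr₂ (f := (shuffle μ).compr₂ (push θ)) (g := shuffle fun a b => θ (μ a b))
    (fun l m => ?_) x y
  simp only [LinearMap.compr₂_apply, shuffle_of]
  induction l, m using shuffleList.induct <;> simp_all [shuffleList, push_cons]

theorem shuffle_push (μ : α' → β' → γ) (f : α → α') (g : β → β') (x : VertexChain α)
    (y : VertexChain β) :
    shuffle μ (push f x) (push g y) = shuffle (fun a b => μ (f a) (g b)) x y := by
  refine hom_congr₂ (f := (shuffle μ).compl₁₂ (push f) (push g))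
    (g := shuffle fun a b => μ (f a) (g b)) (fun l m => ?_) x y
  simp only [LinearMap.compl₁₂_apply, shuffle_of, push_of]
  induction l, m using shuffleList.induct <;> simp_all [shuffleList]

theorem shuffle_singleton_left (μ : α → β → γ) (a : α) (m : List β) (hm : m ≠ []) :
    shuffle μ (of [a]) (of m) = of (m.map (μ a)) := by
  rw [shuffle_of]
  induction m with
  | nil => exact absurd rfl hm
  | cons b m ih =>
    rcases m with _ | ⟨c, m⟩
    · simp [shuffleList]
    · have := ih (by simp)
      rw [shuffleList, this]
      simp [shuffleList]

theorem shuffle_singleton_right (μ : α → β → γ) (l : List α) (b : β) (hl : l ≠ []) :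
    shuffle μ (of l) (of [b]) = of (l.map (μ · b)) := by
  rw [shuffle_of]
  induction l with
  | nil => exact absurd rfl hl
  | cons a l ih =>
    rcases l with _ | ⟨c, l⟩
    · simp [shuffleList]
    · have := ih (by simp)
      rw [shuffleList, this]
      simp [shuffleList]

/-! ### The Alexander–Whitney diagonal -/

/-- The sum `∑ B(w_0 … w_k, w_k … w_m)` over all `k`. -/
noncomputable def diagonalList (B : VertexChain α →ₗ[ℤ] VertexChain α →ₗ[ℤ] M) : List α → M
  | [] => 0
  | a :: l => B (of [a]) (of (a :: l)) + diagonalList (B ∘ₗ cons a) l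

/-- The Alexander–Whitney diagonal, followed by a bilinear map `B`. -/
noncomputable def diagonal (B : VertexChain α →ₗ[ℤ] VertexChain α →ₗ[ℤ] M) :
    VertexChain α →ₗ[ℤ] M :=
  lift (diagonalList B)

@[simp] theorem diagonal_nil (B : VertexChain α →ₗ[ℤ] VertexChain α →ₗ[ℤ] M) :
    diagonal B (of []) = 0 := by simp [diagonal, diagonalList]

theorem diagonal_cons (B : VertexChain α →ₗ[ℤ] VertexChain α →ₗ[ℤ] M) (a : α)
    (x : VertexChain α) :
    diagonal B (cons a x) = B (of [a]) (cons a x) + diagonal (B ∘ₗ cons a) x :=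
  hom_congr (f := diagonal B ∘ₗ cons a) (g := B (of [a]) ∘ₗ cons a + diagonal (B ∘ₗ cons a))
    (by simp [diagonal, diagonalList]) x

theorem diagonal_of_eq_sum (B : VertexChain α →ₗ[ℤ] VertexChain α →ₗ[ℤ] M) (l : List α) :
    diagonal B (of l)
      = ∑ k ∈ Finset.range l.length, B (of (l.take (k + 1))) (of (l.drop k)) := by
  induction l generalizing B with
  | nil => simp
  | cons a l ih =>
    rw [← cons_of, diagonal_cons, ih, cons_of, List.length_cons, Finset.sum_range_succ']
    rw [add_comm]
    simp only [Nat.zero_add, List.take_succ_cons, List.take_zero, List.drop_zero,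
      List.drop_succ_cons, LinearMap.comp_apply, cons_of]

theorem diagonal_congr {B B' : VertexChain α →ₗ[ℤ] VertexChain α →ₗ[ℤ] M} (w : List α)
    (h : ∀ l m : List α, l ≠ [] → m ≠ [] → l.length + m.length = w.length + 1 →
      B (of l) (of m) = B' (of l) (of m)) :
    diagonal B (of w) = diagonal B' (of w) := by
  rw [diagonal_of_eq_sum, diagonal_of_eq_sum]
  refine Finset.sum_congr rfl fun k hk => ?_
  have hk := Finset.mem_range.1 hk
  apply h
  · intro h; have := congrArg List.length h; simp at this; subst this; simp at hk
  · intro h; have := congrArg List.length h; simp at this; omega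
  · simp; omega

theorem diagonal_sub (B B' : VertexChain α →ₗ[ℤ] VertexChain α →ₗ[ℤ] M) (w : List α) :
    diagonal (B - B') (of w) = diagonal B (of w) - diagonal B' (of w) := by
  simp [diagonal_of_eq_sum]

theorem map_diagonal (f : M →ₗ[ℤ] N) (B : VertexChain α →ₗ[ℤ] VertexChain α →ₗ[ℤ] M)
    (x : VertexChain α) : f (diagonal B x) = diagonal (B.compr₂ f) x :=
  hom_congr (f := f ∘ₗ diagonal B) (g := diagonal (B.compr₂ f))
    (fun l => by simp [diagonal_of_eq_sum]) x

theorem diagonal_map (f : β → α) (B : VertexChain α →ₗ[ℤ] VertexChain α →ₗ[ℤ] M)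
    (w : List β) : diagonal B (of (w.map f)) = diagonal (B.compl₁₂ (push f) (push f)) (of w) := by
  simp [diagonal_of_eq_sum, List.map_take, List.map_drop]

/-- Deleting the shared vertex from the back face at one cut cancels deleting it from the front face
at the next cut. Only the two extreme cuts leave a term with an empty factor. -/
theorem diagonal_boundary (B : VertexChain α →ₗ[ℤ] VertexChain α →ₗ[ℤ] M) (w : List α) :
    diagonal (B ∘ₗ boundary - B.compl₁₂ sgn boundary) (of w)
      = diagonal B (boundary (of w)) + B (of []) (of w) - B (sgn (of w)) (of []) := by
  induction w generalizing B with
  | nil => simp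
  | cons a l ih =>
    have hB : (B ∘ₗ boundary - B.compl₁₂ sgn boundary) ∘ₗ cons a
        = B - ((B ∘ₗ cons a) ∘ₗ boundary - (B ∘ₗ cons a).compl₁₂ sgn boundary) := by
      refine LinearMap.ext fun x => LinearMap.ext fun y => ?_
      simp only [LinearMap.comp_apply, LinearMap.sub_apply, LinearMap.compl₁₂_apply,
        boundary_cons, sgn_cons, map_sub, map_neg, LinearMap.neg_apply]
      abel
    rw [← cons_of, diagonal_cons, hB, diagonal_sub, ih, boundary_cons, map_sub, diagonal_cons,
      sgn_cons]
    simp [boundary_of_cons]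
    abel

end VertexChain

namespace VertexChain

variable {α β γ M N : Type*} [AddCommGroup M] [AddCommGroup N]

/-! ### Truncation -/

/-- The projection which kills the lists with at most one vertex. -/
noncomputable def truncate : VertexChain α →ₗ[ℤ] VertexChain α :=
  lift fun l => if 2 ≤ l.length then of l else 0

theorem truncate_of (l : List α) :
    truncate (of l) = if 2 ≤ l.length then of l else 0 := lift_of _ _

theorem truncate_of_le {l : List α} (h : l.length ≤ 1) : truncate (of l) = 0 := by
  rw [truncate_of, if_neg (by omega)]

theorem truncate_of_lt {l : List α} (h : 2 ≤ l.length) : truncate (of l) = of l := by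
  rw [truncate_of, if_pos h]

theorem truncate_cons_cons (a b : α) (x : VertexChain α) :
    truncate (cons a (cons b x)) = cons a (cons b x) :=
  hom_congr (f := truncate ∘ₗ cons a ∘ₗ cons b) (g := cons a ∘ₗ cons b)
    (fun l => by simp [truncate_of]) x

theorem push_truncate (f : α → β) (x : VertexChain α) :
    push f (truncate x) = truncate (push f x) := by
  refine hom_congr (f := push f ∘ₗ truncate) (g := truncate ∘ₗ push f) (fun l => ?_) x
  by_cases h : 2 ≤ l.length <;> simp [truncate_of, h]

/-- Truncation fails to commute with the boundary only on edges, where the discrepancy is a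
difference of two vertices. -/
theorem apply_truncate_boundary (X : VertexChain α →ₗ[ℤ] M)
    (hX : ∀ a b, X (of [a]) = X (of [b])) (x : VertexChain α) :
    X (truncate (boundary x)) = X (boundary (truncate x)) := by
  refine hom_congr (f := X ∘ₗ truncate ∘ₗ boundary) (g := X ∘ₗ boundary ∘ₗ truncate)
    (fun l => ?_) x
  rcases l with _ | ⟨a, _ | ⟨b, _ | ⟨c, l⟩⟩⟩
  · simp [truncate_of]
  · simp [truncate_of, boundary_of_cons]
  · simp [truncate_of, boundary_of_cons, hX a b]
  · simp only [LinearMap.comp_apply]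
    rw [truncate_of_lt (l := a :: b :: c :: l) (by simp), boundary_of_cons, boundary_of_cons,
      map_sub (cons a), map_sub truncate, map_sub truncate, truncate_cons_cons, cons_of,
      truncate_of_lt (by simp), truncate_of_lt (by simp)]

/-- Truncating the second factor removes exactly the last cut, whose back face is a single vertex.
-/
theorem diagonal_truncate (B : VertexChain α →ₗ[ℤ] VertexChain α →ₗ[ℤ] M)
    (E : VertexChain α →ₗ[ℤ] M) (hE : ∀ (l : List α) (b : α), l ≠ [] → B (of l) (of [b]) = E (of l))
    (w : List α) (hw : w ≠ []) :
    diagonal B (of w) = diagonal (B.compl₂ truncate) (of w) + E (of w) := by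
  induction w generalizing B E with
  | nil => exact absurd rfl hw
  | cons a w ih =>
    rcases w with _ | ⟨b, w⟩
    · rw [← cons_of, diagonal_cons, diagonal_cons]
      simp [truncate_of, hE]
    · have := ih (B ∘ₗ cons a) (E ∘ₗ cons a) (fun l b _ => by simpa using hE (a :: l) b (by simp))
        (by simp)
      rw [← cons_of, diagonal_cons, diagonal_cons, this]
      simp only [LinearMap.compl₂_apply, cons_of, LinearMap.comp_apply]
      rw [truncate_of_lt (by simp), add_assoc]
      rfl

/-! ### Degenerate simplices and sizes of chains -/

/-- A list of vertices is nondegenerate if no two adjacent vertices agree. -/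
def Nondegenerate (l : List α) : Prop := l.IsChain (· ≠ ·)

theorem not_nondegenerate_cons_cons (a : α) (l : List α) : ¬ Nondegenerate (a :: a :: l) := by
  simp [Nondegenerate]

theorem not_nondegenerate_cons {a : α} {l : List α} (h : ¬ Nondegenerate l) :
    ¬ Nondegenerate (a :: l) := fun h' => h (List.IsChain.tail h')

/-- `Size d n x` says that `x` is a signed sum of lists with `d` vertices, of which at most `n` are
nondegenerate. -/
inductive Size (d : ℕ) : ℕ → VertexChain α → Prop
  | zero : Size d 0 0
  | succ {n x} (h : Size d n x) : Size d (n + 1) x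
  | add_of {n x} (ε : ℤˣ) (l : List α) (hl : l.length = d) (h : Size d n x) :
      Size d (n + 1) (x + ε • of l)
  | add_degenerate {n x} (ε : ℤˣ) (l : List α) (hl : l.length = d) (hd : ¬ Nondegenerate l)
      (h : Size d n x) : Size d n (x + ε • of l)

namespace Size

variable {d m n : ℕ} {x y : VertexChain α}

theorem mono (h : Size d m x) (hmn : m ≤ n) : Size d n x := by
  induction hmn with
  | refl => exact h
  | step _ ih => exact ih.succ

theorem zero' : Size d n (0 : VertexChain α) := Size.zero.mono (Nat.zero_le n)

theorem of (l : List α) (hl : l.length = d) : Size d 1 (of l) := by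
  simpa using Size.zero.add_of 1 l hl

theorem of_degenerate (l : List α) (hl : l.length = d) (hd : ¬ Nondegenerate l) :
    Size d 0 (VertexChain.of l) := by
  simpa using Size.zero.add_degenerate 1 l hl hd

theorem add (hx : Size d m x) (hy : Size d n y) : Size d (m + n) (x + y) := by
  induction hy with
  | zero => simpa using hx
  | succ _ ih => exact ih.succ
  | add_of ε l hl _ ih => rw [← add_assoc x]; exact ih.add_of ε l hl
  | add_degenerate ε l hl hd _ ih => rw [← add_assoc x]; exact ih.add_degenerate ε l hl hd

theorem unit_smul (ε : ℤˣ) (hx : Size d m x) : Size d m (ε • x) := by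
  induction hx with
  | zero => simpa using Size.zero
  | succ _ ih => exact ih.succ
  | add_of δ l hl _ ih => rw [smul_add, smul_smul]; exact ih.add_of _ l hl
  | add_degenerate δ l hl hd _ ih => rw [smul_add, smul_smul]; exact ih.add_degenerate _ l hl hd

theorem neg (hx : Size d m x) : Size d m (-x) := by
  simpa using hx.unit_smul (-1)

theorem sub (hx : Size d m x) (hy : Size d n y) : Size d (m + n) (x - y) := by
  rw [sub_eq_add_neg]; exact hx.add hy.neg

theorem neg_one_pow_smul (k : ℕ) (hx : Size d m x) : Size d m ((-1 : ℤ) ^ k • x) := by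
  rcases neg_one_pow_eq_or ℤ k with h | h <;> rw [h]
  · simpa using hx
  · simpa using hx.neg

theorem sum {ι : Type*} (s : Finset ι) (f : ι → VertexChain α) (b : ι → ℕ)
    (h : ∀ i ∈ s, Size d (b i) (f i)) : Size d (∑ i ∈ s, b i) (∑ i ∈ s, f i) := by
  classical
  induction s using Finset.induction_on with
  | empty => simpa using Size.zero
  | insert i s hi ih =>
    rw [Finset.sum_insert hi, Finset.sum_insert hi]
    exact (h i (by simp)).add (ih fun j hj => h j (by simp [hj]))

/-- Degenerate summands are still present in the chain, so an operator may be applied without loss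
only if it sends them to degenerate ones. -/
theorem map {e c : ℕ} (T : VertexChain α →ₗ[ℤ] VertexChain β)
    (hT : ∀ l : List α, l.length = d → Size e c (T (VertexChain.of l)))
    (hT' : ∀ l : List α, l.length = d → ¬ Nondegenerate l → Size e 0 (T (VertexChain.of l)))
    (hx : Size d m x) : Size e (m * c) (T x) := by
  induction hx with
  | zero => simpa using Size.zero
  | succ _ ih => exact ih.mono (by gcongr; omega)
  | add_of ε l hl _ ih =>
    rw [map_add, add_mul, one_mul, Units.smul_def, map_smul, ← Units.smul_def]
    exact ih.add ((hT l hl).unit_smul ε)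
  | add_degenerate ε l hl hd _ ih =>
    rw [map_add, Units.smul_def, map_smul, ← Units.smul_def]
    exact ih.add ((hT' l hl hd).unit_smul ε)

theorem cons (a : α) (hx : Size d m x) : Size (d + 1) m (VertexChain.cons a x) := by
  simpa using hx.map (e := d + 1) (c := 1) (VertexChain.cons a)
    (fun l hl => by rw [cons_of]; exact Size.of (a :: l) (by simp [hl]))
    (fun l hl hd => by
      rw [cons_of]; exact Size.of_degenerate (a :: l) (by simp [hl]) (not_nondegenerate_cons hd))

theorem sgn_eq (hx : Size d m x) : sgn x = (-1 : ℤ) ^ d • x := by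
  induction hx with
  | zero => simp
  | succ _ ih => exact ih
  | add_of ε l hl _ ih =>
    rw [map_add, ih, Units.smul_def, map_smul, sgn_of, hl, smul_add, smul_comm]
  | add_degenerate ε l hl hd _ ih =>
    rw [map_add, ih, Units.smul_def, map_smul, sgn_of, hl, smul_add, smul_comm]

end Size

theorem size_prism (f g : α → β) (l : List α) :
    Size (l.length + 1) l.length (prism f g (of l)) := by
  induction l with
  | nil => simpa using Size.zero
  | cons a l ih =>
    rw [← cons_of, prism_cons]
    simpa [add_comm] using (Size.of (f a :: g a :: l.map g) (by simp)).sub (ih.cons (f a))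

/-- The number of lattice paths through two lists with `p` and `q` vertices. -/
def pathCount : ℕ → ℕ → ℕ
  | _, 0 => 0
  | 0, 1 => 1
  | 0, _ + 2 => 0
  | p + 1, q + 1 => pathCount p (q + 1) + pathCount (p + 1) q

theorem pathCount_succ (p q : ℕ) : pathCount (p + 1) (q + 1) = (p + q).choose p := by
  induction p generalizing q with
  | zero =>
    induction q with
    | zero => simp [pathCount]
    | succ q ih => rw [pathCount, ih]; simp [pathCount]
  | succ p ihp =>
    induction q with
    | zero => rw [pathCount, ihp]; simp [pathCount]
    | succ q ih =>
      rw [pathCount, ihp, ih, show p + 1 + (q + 1) = (p + (q + 1)) + 1 by ring,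
        Nat.choose_succ_succ, show p + 1 + q = p + (q + 1) by ring]

theorem size_shuffleList (μ : α → β → γ) (l : List α) (m : List β) :
    Size (l.length + m.length - 1) (pathCount l.length m.length) (shuffleList μ l m) := by
  induction l, m using shuffleList.induct with
  | case1 => simpa [shuffleList] using Size.zero'
  | case2 b => simpa [shuffleList, pathCount] using Size.of ([] : List γ) rfl
  | case3 => simpa [shuffleList] using Size.zero'
  | case4 => simpa [shuffleList] using Size.zero'
  | case5 a l b m ih1 ih2 =>
    rw [shuffleList]
    have h2 := ih2.neg_one_pow_smul l.length
    rw [show (a :: l).length + m.length - 1 = l.length + (b :: m).length - 1 by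
      simp] at h2
    have := (ih1.add h2).cons (μ a b)
    simpa [pathCount, show l.length + 1 + (m.length + 1) - 1 = l.length + (m.length + 1) - 1 + 1 by
      omega] using this

theorem size_shuffle (μ : α → β → γ) {l : List α} {m : List β} {p q : ℕ} (hl : l.length = p + 1)
    (hm : m.length = q + 1) :
    Size (p + q + 1) ((p + q).choose p) (shuffle μ (of l) (of m)) := by
  rw [shuffle_of, ← pathCount_succ, ← hl, ← hm]
  simpa [hl, hm, show p + 1 + (q + 1) - 1 = p + q + 1 by omega] using size_shuffleList μ l m

/-- Each step of a lattice path moves in one factor only. The step between the two equal neighbours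
in `l` therefore repeats a vertex, so every path is degenerate. -/
theorem size_shuffle_of_degenerate (μ : α → β → γ) {l : List α} (hl : ¬ Nondegenerate l)
    (m : List β) : Size (l.length + m.length - 1) 0 (shuffle μ (of l) (of m)) := by
  rw [shuffle_of]
  induction l, m using shuffleList.induct with
  | case1 => simpa [shuffleList] using Size.zero'
  | case2 b => exact absurd List.isChain_nil hl
  | case3 => simpa [shuffleList] using Size.zero'
  | case4 => simpa [shuffleList] using Size.zero'
  | case5 a l b m ih1 ih2 =>
    have key : Size (l.length + m.length + 1) 0
        (VertexChain.cons (μ a b) (shuffleList μ l (b :: m))) := by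
      by_cases hl' : Nondegenerate l
      · rcases l with _ | ⟨a', l⟩
        · exact absurd (List.isChain_singleton _) hl
        · obtain rfl : a = a' := by
            by_contra hne
            exact hl (List.isChain_cons_cons.2 ⟨hne, hl'⟩)
          rw [shuffleList]
          have h1 := size_shuffleList μ l (b :: m)
          have h2 := (size_shuffleList μ (a :: l) m).neg_one_pow_smul l.length
          rw [show (a :: l).length + m.length - 1 = l.length + (b :: m).length - 1 by
            simp] at h2
          have h3 := h1.add h2
          rw [show (a :: l).length + m.length + 1 = l.length + (m.length + 1 + 1) by
            simp only [List.length_cons]; omega]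
          simpa only [mul_zero, LinearMap.comp_apply] using h3.map
            (VertexChain.cons (μ a b) ∘ₗ VertexChain.cons (μ a b))
            (e := l.length + (m.length + 1 + 1)) (c := 0)
            (fun l' hl' => by
              simpa using Size.of_degenerate (μ a b :: μ a b :: l')
                (by simp [hl', add_assoc]) (not_nondegenerate_cons_cons _ _))
            (fun l' hl' _ => by
              simpa using Size.of_degenerate (μ a b :: μ a b :: l')
                (by simp [hl', add_assoc]) (not_nondegenerate_cons_cons _ _))
      · simpa using (ih1 hl').cons (μ a b)
    have key2 : Size (l.length + m.length + 1) 0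
        (VertexChain.cons (μ a b) ((-1 : ℤ) ^ l.length • shuffleList μ (a :: l) m)) := by
      simpa [show l.length + 1 + m.length - 1 = l.length + m.length by omega] using
        ((ih2 hl).neg_one_pow_smul l.length).cons (μ a b)
    rw [shuffleList, map_add]
    simpa [show l.length + 1 + (m.length + 1) - 1 = l.length + m.length + 1 by omega] using
      key.add key2

/-! ### The relations of the bar complex -/

/-- The chains of vertices in a group which vanish in the normalized bar complex. -/
noncomputable def barRelations (K : Type*) [Group K] : Submodule ℤ (VertexChain K) :=
  Submodule.span ℤ ({x | ∃ l : List K, ¬ Nondegenerate l ∧ x = of l} ∪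
    {x | ∃ (k : K) (l : List K), x = of (l.map (k * ·)) - of l})

section barRelations

variable {G K : Type*} [Group G] [Group K]

/-- The class of a chain of vertices in the normalized bar complex. -/
noncomputable abbrev barClass (K : Type*) [Group K] :
    VertexChain K →ₗ[ℤ] VertexChain K ⧸ barRelations K :=
  (barRelations K).mkQ

theorem barClass_of_degenerate {l : List K} (h : ¬ Nondegenerate l) : barClass K (of l) = 0 :=
  (Submodule.Quotient.mk_eq_zero _).2 (Submodule.subset_span (Or.inl ⟨l, h, rfl⟩))

theorem barClass_translate (k : K) (x : VertexChain K) :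
    barClass K (push (k * ·) x) = barClass K x := by
  refine hom_congr (f := barClass K ∘ₗ push (k * ·)) (g := barClass K) (fun l => ?_) x
  rw [LinearMap.comp_apply, push_of, ← sub_eq_zero, ← map_sub]
  exact (Submodule.Quotient.mk_eq_zero _).2 (Submodule.subset_span (Or.inr ⟨k, l, rfl⟩))

theorem barClass_of_size_zero {d : ℕ} {x : VertexChain K} (h : Size d 0 x) :
    barClass K x = 0 := by
  generalize hn : 0 = n at h
  induction h with
  | zero => simp
  | succ => simp at hn
  | add_of => simp at hn
  | add_degenerate ε l hl hd h ih =>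
    rw [map_add, ih hn, Units.smul_def, map_smul, barClass_of_degenerate hd, smul_zero, add_zero]

/-- This is the universal property of the quotient by `barRelations`, used both for shuffle products
and for the passage to cellular chains. -/
theorem map_eq_zero_of_barClass {X : VertexChain K →ₗ[ℤ] M}
    (hd : ∀ l, ¬ Nondegenerate l → X (of l) = 0)
    (ht : ∀ (k : K) l, X (of (l.map (k * ·))) = X (of l)) {x y : VertexChain K}
    (hx : barClass K x = barClass K y) : X x = X y := by
  rw [← sub_eq_zero, ← map_sub, ← LinearMap.mem_ker]
  rw [← sub_eq_zero, ← map_sub] at hx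
  refine Submodule.span_le.2 ?_ ((Submodule.Quotient.mk_eq_zero _).1 hx)
  rintro _ (⟨l, hl, rfl⟩ | ⟨k, l, rfl⟩)
  · exact hd l hl
  · simp [ht]

end barRelations

end VertexChain

/-! ### Arithmetic of the control function. -/

theorem gammaFun_sub_qFun {m : ℕ} (hm : 1 ≤ m) :
    (gammaFun m : ℤ) - qFun m = 2 * 2 ^ m - 1
      + ∑ k ∈ Finset.Icc 1 (m - 1), ((gammaFun k : ℤ) - qFun k) * ((m + 1).choose (m - k) : ℤ) := by
  rw [gammaFun_rec hm, qFun_rec hm]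
  simp only [sub_mul, Finset.sum_sub_distrib]
  push_cast [Nat.cast_sub hm]
  ring

theorem qFun_le_gammaFun (m : ℕ) : qFun m ≤ gammaFun m := by
  induction m using Nat.strong_induction_on with
  | _ m ih =>
  rcases Nat.eq_zero_or_pos m with rfl | hm
  · simp [qFun_zero, gammaFun_zero]
  · have h := gammaFun_sub_qFun hm
    have h1 : (0 : ℤ) ≤ ∑ k ∈ Finset.Icc 1 (m - 1),
        ((gammaFun k : ℤ) - qFun k) * ((m + 1).choose (m - k) : ℤ) := by
      refine Finset.sum_nonneg fun k hk => mul_nonneg ?_ (by positivity)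
      have := ih k (by have := Finset.mem_Icc.1 hk; omega)
      omega
    have h2 : (1 : ℤ) ≤ 2 ^ m := one_le_pow₀ (by norm_num)
    omega

theorem cFun_cast (m : ℕ) : (cFun m : ℤ) = gammaFun m - qFun m := by
  rw [cFun, Nat.cast_sub (qFun_le_gammaFun m)]

theorem cFun_cast_rec {m : ℕ} (hm : 1 ≤ m) : (cFun m : ℤ) = 2 * 2 ^ m - 1
    + ∑ k ∈ Finset.Icc 1 (m - 1), (cFun k : ℤ) * ((m + 1).choose (m - k) : ℤ) := by
  simp only [cFun_cast]
  exact gammaFun_sub_qFun hm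

theorem cFun_zero : cFun 0 = 0 := by simp [cFun, gammaFun_zero]

/-- The subtraction-free form of the recursion; the term k = 0 may be included because c(0) = 0. -/
theorem cFun_add_one {m : ℕ} (hm : 1 ≤ m) :
    cFun m + 1 = 2 * 2 ^ m + ∑ k ∈ Finset.range m, cFun k * (m + 1).choose (m - k) := by
  have h : ∑ k ∈ Finset.range m, cFun k * (m + 1).choose (m - k)
      = ∑ k ∈ Finset.Icc 1 (m - 1), cFun k * (m + 1).choose (m - k) := by
    refine (Finset.sum_subset (fun k hk => ?_) fun k hk hk' => ?_).symm
    · have := Finset.mem_Icc.1 hk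
      exact Finset.mem_range.2 (by omega)
    · have h0 : k = 0 := by
        simp only [Finset.mem_Icc, Finset.mem_range] at hk hk'
        omega
      rw [h0, cFun_zero, zero_mul]
  have h' := cFun_cast_rec hm
  rw [h]
  zify
  rw [h']
  ring

/-- Needed because the diameter function takes a supremum over all lower dimensions. The binomial
coefficients grow by Pascal's rule. -/
theorem cFun_monotone : Monotone cFun := by
  refine monotone_nat_of_le_succ fun m => ?_
  rcases Nat.eq_zero_or_pos m with rfl | hm
  · simp [cFun_zero]
  · have h1 := cFun_add_one hm
    have h2 := cFun_add_one (m := m + 1) (by omega)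
    have h3 : ∑ k ∈ Finset.range m, cFun k * (m + 1).choose (m - k)
        ≤ ∑ k ∈ Finset.range (m + 1), cFun k * (m + 1 + 1).choose (m + 1 - k) := by
      rw [Finset.sum_range_succ]
      refine le_add_right (Finset.sum_le_sum fun k hk => Nat.mul_le_mul_left _ ?_)
      rw [Nat.succ_sub (Finset.mem_range.1 hk).le, Nat.choose_succ_succ]
      exact Nat.le_add_right _ _
    have h4 : 2 ^ m ≤ 2 ^ (m + 1) := Nat.pow_le_pow_right (by norm_num) (by omega)
    omega

theorem cFun_values : cFun 0 = 0 ∧ cFun 1 = 3 ∧ cFun 2 = 16 ∧ cFun 3 = 97 ∧ cFun 4 = 706 ∧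
    cFun 5 = 6119 ∧ cFun 6 = 61804 ∧ cFun 7 = 713325 := by
  have h0 := cFun_zero
  have h1 := cFun_add_one (m := 1) (by norm_num)
  have h2 := cFun_add_one (m := 2) (by norm_num)
  have h3 := cFun_add_one (m := 3) (by norm_num)
  have h4 := cFun_add_one (m := 4) (by norm_num)
  have h5 := cFun_add_one (m := 5) (by norm_num)
  have h6 := cFun_add_one (m := 6) (by norm_num)
  have h7 := cFun_add_one (m := 7) (by norm_num)
  simp only [Finset.sum_range_succ, Finset.sum_range_zero, h0] at h1 h2 h3 h4 h5 h6 h7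
  norm_num [Nat.choose] at h1 h2 h3 h4 h5 h6 h7
  omega

namespace VertexChain

variable {α β γ M N : Type*} [AddCommGroup M] [AddCommGroup N]

/-! ### The Eilenberg–Mac Lane homotopy along the diagonal -/

/-- The Alexander–Whitney diagonal followed by the shuffle product, as an augmentation preserving
chain map. -/
noncomputable def shuffleDiagonal (μ : α → α → γ) : VertexChain α →ₗ[ℤ] VertexChain γ :=
  diagonal (shuffle μ) + lift fun l => if l = [] then of [] else 0

@[simp] theorem shuffleDiagonal_nil (μ : α → α → γ) : shuffleDiagonal μ (of []) = of [] := by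
  simp [shuffleDiagonal]

theorem shuffleDiagonal_of {μ : α → α → γ} {l : List α} (h : l ≠ []) :
    shuffleDiagonal μ (of l) = diagonal (shuffle μ) (of l) := by
  simp [shuffleDiagonal, h]

theorem boundary_shuffleDiagonal (μ : α → α → γ) (x : VertexChain α) :
    boundary (shuffleDiagonal μ x) = shuffleDiagonal μ (boundary x) := by
  refine hom_congr (f := boundary ∘ₗ shuffleDiagonal μ) (g := shuffleDiagonal μ ∘ₗ boundary)
    (fun l => ?_) x
  rcases l with _ | ⟨a, l⟩
  · simp
  have hB : (shuffle μ).compr₂ boundary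
      = shuffle μ ∘ₗ boundary - (shuffle μ).compl₁₂ sgn boundary :=
    LinearMap.ext fun x => LinearMap.ext fun y => boundary_shuffle μ x y
  have h0 (y : VertexChain α) : (lift fun l : List α => if l = [] then of ([] : List γ) else 0)
      (cons a y) = 0 :=
    hom_congr (f := (lift fun l : List α => if l = [] then of ([] : List γ) else 0) ∘ₗ cons a)
      (g := 0) (by simp) y
  simp only [LinearMap.comp_apply]
  rw [shuffleDiagonal_of (by simp), map_diagonal, hB, diagonal_boundary, shuffle_nil_right, sub_zero,
    shuffleDiagonal, LinearMap.add_apply, boundary_of_cons, map_sub (lift _), h0, sub_zero, lift_of]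
  congr 1
  rcases l with _ | ⟨b, l⟩ <;> simp [shuffle_of, shuffleList]

theorem shuffleDiagonal_map (μ : β → β → γ) (f : α → β) (l : List α) :
    shuffleDiagonal μ (of (l.map f)) = shuffleDiagonal (fun a b => μ (f a) (f b)) (of l) := by
  have hB : (shuffle μ).compl₁₂ (push f) (push f) = shuffle fun a b => μ (f a) (f b) :=
    LinearMap.ext fun x => LinearMap.ext fun y => shuffle_push μ f f x y
  simp [shuffleDiagonal, diagonal_map, hB]

theorem push_shuffleDiagonal (θ : β → γ) (μ : α → α → β) (l : List α) :
    push θ (shuffleDiagonal μ (of l)) = shuffleDiagonal (fun a b => θ (μ a b)) (of l) := by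
  have hB : (shuffle μ).compr₂ (push θ) = shuffle fun a b => θ (μ a b) :=
    LinearMap.ext fun x => LinearMap.ext fun y => push_shuffle θ μ x y
  simp only [shuffleDiagonal, LinearMap.add_apply, map_add, map_diagonal, hB, lift_of]
  split_ifs <;> simp

/-- The Eilenberg–Mac Lane homotopy on a list of vertices. -/
noncomputable def diagonalHomotopyList (μ : α → α → γ) : List α → VertexChain γ
  | [] => 0
  | a :: l => -cons (μ a a) (shuffleDiagonal μ (of (a :: l)) + diagonalHomotopyList μ l)

/-- The Eilenberg–Mac Lane homotopy between the diagonal and the composition of the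
Alexander–Whitney map and the shuffle map. -/
noncomputable def diagonalHomotopy (μ : α → α → γ) : VertexChain α →ₗ[ℤ] VertexChain γ :=
  lift (diagonalHomotopyList μ)

@[simp] theorem diagonalHomotopy_nil (μ : α → α → γ) : diagonalHomotopy μ (of []) = 0 := by
  simp [diagonalHomotopy, diagonalHomotopyList]

theorem diagonalHomotopy_cons (μ : α → α → γ) (a : α) (x : VertexChain α) :
    diagonalHomotopy μ (cons a x)
      = -cons (μ a a) (shuffleDiagonal μ (cons a x) + diagonalHomotopy μ x) :=
  hom_congr (f := diagonalHomotopy μ ∘ₗ cons a)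
    (g := -(cons (μ a a) ∘ₗ (shuffleDiagonal μ ∘ₗ cons a + diagonalHomotopy μ)))
    (by simp [diagonalHomotopy, diagonalHomotopyList]) x

/-- The homotopy is the contraction of a cone on the vertex `μ a a`, with the terms that would begin
with `μ a a` twice left out. The identity nevertheless holds exactly, before normalization; this
uses that `shuffleDiagonal` preserves the augmentation. -/
theorem boundary_diagonalHomotopy (μ : α → α → γ) (x : VertexChain α) :
    boundary (diagonalHomotopy μ x) + diagonalHomotopy μ (boundary x)
      = push (fun a => μ a a) x - shuffleDiagonal μ x := by
  refine hom_congr (f := boundary ∘ₗ diagonalHomotopy μ + diagonalHomotopy μ ∘ₗ boundary)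
    (g := push (fun a => μ a a) - shuffleDiagonal μ) (fun l => ?_) x
  induction l with
  | nil => simp
  | cons a l ih =>
    simp only [LinearMap.comp_apply, LinearMap.add_apply, LinearMap.sub_apply] at ih ⊢
    have ih' := congrArg (cons (μ a a)) ih
    rw [← cons_of]
    simp only [diagonalHomotopy_cons, boundary_cons, push_cons, map_sub, map_add, map_neg,
      boundary_shuffleDiagonal] at ih' ⊢
    rw [← eq_sub_iff_add_eq] at ih'
    rw [ih']
    abel

theorem diagonalHomotopy_map (μ : β → β → γ) (f : α → β) (l : List α) :
    diagonalHomotopy μ (of (l.map f)) = diagonalHomotopy (fun a b => μ (f a) (f b)) (of l) := by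
  induction l with
  | nil => simp
  | cons a l ih =>
    rw [List.map_cons, ← cons_of, diagonalHomotopy_cons, cons_of, ← List.map_cons,
      shuffleDiagonal_map, ih, ← cons_of, diagonalHomotopy_cons]

theorem push_diagonalHomotopy (θ : β → γ) (μ : α → α → β) (l : List α) :
    push θ (diagonalHomotopy μ (of l)) = diagonalHomotopy (fun a b => θ (μ a b)) (of l) := by
  induction l with
  | nil => simp
  | cons a l ih =>
    rw [← cons_of, diagonalHomotopy_cons, diagonalHomotopy_cons, map_neg, push_cons, map_add, ih,
      cons_of, push_shuffleDiagonal]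

theorem size_diagonalHomotopy (μ : α → α → γ) (l : List α) :
    Size (l.length + 1) (∑ k ∈ Finset.range l.length, (2 ^ k - 1)) (diagonalHomotopy μ (of l)) := by
  induction l with
  | nil => simpa using Size.zero
  | cons a l ih =>
    -- The cut at the first vertex gives a simplex already starting at `μ a a`, so its cone is free
    -- of charge. The other cuts contribute all binomial coefficients but one, that is 2^length - 1.
    have h1 : Size (l.length + 2) 0 (cons (μ a a) (shuffle μ (of [a]) (of (a :: l)))) := by
      rw [shuffle_singleton_left μ a _ (by simp), cons_of]
      exact Size.of_degenerate _ (by simp) (not_nondegenerate_cons_cons _ _)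
    have h2 : Size (l.length + 1) (2 ^ l.length - 1) (diagonal (shuffle μ ∘ₗ cons a) (of l)) := by
      have hsum : 2 ^ l.length - 1
          = ∑ k ∈ Finset.range l.length, l.length.choose (k + 1) := by
        have := Nat.sum_range_choose l.length
        rw [Finset.sum_range_succ'] at this
        simp at this
        omega
      rw [hsum, diagonal_of_eq_sum]
      refine Size.sum _ _ _ fun k hk => ?_
      have hk := Finset.mem_range.1 hk
      have := size_shuffle μ (l := a :: l.take (k + 1)) (m := l.drop k) (p := k + 1)
        (q := l.length - k - 1) (by simp; omega) (by simp; omega)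
      rw [show k + 1 + (l.length - k - 1) = l.length by omega] at this
      simpa using this
    rw [← cons_of, diagonalHomotopy_cons, cons_of, shuffleDiagonal_of (by simp), ← cons_of,
      diagonal_cons, add_assoc, map_add, List.length_cons, Finset.sum_range_succ,
      add_comm (Finset.sum _ _)]
    simpa using (h1.add ((h2.add ih).cons (μ a a))).neg

theorem sum_two_pow_sub_one (m : ℕ) :
    ∑ k ∈ Finset.range (m + 1), (2 ^ k - 1) + (m + 2) = 2 ^ (m + 1) := by
  induction m with
  | zero => simp
  | succ m ih =>
    have := Nat.one_le_two_pow (n := m + 1)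
    rw [Finset.sum_range_succ, pow_succ]
    omega

end VertexChain

/-! ### Null homotopies and their extension along a mitosis. -/

namespace VertexChain

variable {G K K' : Type*} [Group G] [Group K] [Group K']

/-- A lift to chains of vertices of a partial chain homotopy of dimension `n` between a homomorphism
and the trivial homomorphism, controlled by `cFun`. -/
structure IsNullHomotopy (f : G →* K) (n : ℕ) (P : VertexChain G →ₗ[ℤ] VertexChain K) : Prop where
  size : ∀ w : List G, Size (w.length + 1) (cFun (w.length - 1)) (P (of w))
  vanish : ∀ w : List G, w.length ≤ 1 → P (of w) = 0
  invariant : ∀ (k : G) (w : List G), barClass K (P (of (w.map (k * ·)))) = barClass K (P (of w))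
  homotopy : ∀ w : List G, w.length ≤ n + 1 →
    barClass K (boundary (P (of w)) + P (boundary (of w)))
      = barClass K (push f (of w) - push (fun _ => 1) (of w))

theorem barClass_singleton (a b : K) : barClass K (of [a]) = barClass K (of [b]) := by
  have := barClass_translate (b * a⁻¹) (of [a])
  simpa using this.symm

theorem isNullHomotopy_zero (f : G →* K) : IsNullHomotopy f 0 0 where
  size w := Size.zero'
  vanish w _ := rfl
  invariant k w := rfl
  homotopy w hw := by
    rcases w with _ | ⟨a, _ | ⟨b, w⟩⟩
    · simp
    · simp only [LinearMap.zero_apply, map_zero, add_zero, push_of, map_sub, List.map_cons,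
        List.map_nil]
      rw [barClass_singleton (f a) 1, sub_self]
    · simp at hw

section Step

variable {f : G →* K} {j : K →* K'} {u t : K'} {P : VertexChain G →ₗ[ℤ] VertexChain K} {n : ℕ}

/-- Translating the left factor by `k` translates the product by `j k`, and degenerate left factors
have degenerate products. The commutation relation is not involved on this side. -/
theorem barClass_shuffle_congr {x x' : VertexChain K} (hx : barClass K x = barClass K x')
    (y : VertexChain G) :
    barClass K' (shuffle (fun k b => j k * (u * j (f b) * u⁻¹)) x y)
      = barClass K' (shuffle (fun k b => j k * (u * j (f b) * u⁻¹)) x' y) := by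
  refine hom_congr (f := barClass K' ∘ₗ shuffle _ x) (g := barClass K' ∘ₗ shuffle _ x')
    (fun m => ?_) y
  refine map_eq_zero_of_barClass (X := barClass K' ∘ₗ (shuffle _).flip (of m)) (fun l hl => ?_)
    (fun k l => ?_) hx
  · exact barClass_of_size_zero (size_shuffle_of_degenerate _ hl m)
  · simp only [LinearMap.comp_apply, LinearMap.flip_apply]
    rw [← barClass_translate (j k) (shuffle _ (of l) (of m)), push_shuffle]
    have := shuffle_push (fun k b => j k * (u * j (f b) * u⁻¹)) (k * ·) id (of l) (of m)
    rw [push_of, push_of, List.map_id] at this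
    rw [this]
    simp only [map_mul, mul_assoc, id]

/-- Here the commutation relation enters: the translating element u · j (f k) · u⁻¹ has to be moved
past the left factor. -/
theorem barClass_shuffle_translate
    (hcomm : ∀ a b : K, j a * (u * j b * u⁻¹) = u * j b * u⁻¹ * j a)
    (x : VertexChain K) (k : G) (y : VertexChain G) :
    barClass K' (shuffle (fun k b => j k * (u * j (f b) * u⁻¹)) x (push (k * ·) y))
      = barClass K' (shuffle (fun k b => j k * (u * j (f b) * u⁻¹)) x y) := by
  have := shuffle_push (fun k b => j k * (u * j (f b) * u⁻¹)) id (k * ·) x y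
  have hid : push (id : K → K) x = x := hom_congr (f := push id) (g := LinearMap.id) (by simp) x
  rw [hid] at this
  have h := barClass_translate (u * j (f k) * u⁻¹)
    (shuffle (fun k b => j k * (u * j (f b) * u⁻¹)) x y)
  rw [push_shuffle] at h
  rw [this, ← h]
  congr 4
  funext a b
  rw [← mul_assoc (u * j (f k) * u⁻¹), ← hcomm]
  simp [mul_assoc]

/-- A right factor consisting of one vertex multiplies all vertices by the same element; by
commutation this is a left translation. -/
theorem barClass_shuffle_singleton
    (hcomm : ∀ a b : K, j a * (u * j b * u⁻¹) = u * j b * u⁻¹ * j a)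
    (x : VertexChain K) (b : G) :
    barClass K' (shuffle (fun k b => j k * (u * j (f b) * u⁻¹)) x (of [b]))
      = barClass K' (push j x) := by
  refine hom_congr (f := barClass K' ∘ₗ (shuffle _).flip (of [b])) (g := barClass K' ∘ₗ push j)
    (fun l => ?_) x
  simp only [LinearMap.comp_apply, LinearMap.flip_apply]
  by_cases hl : l = []
  · subst hl
    simp [shuffle_of, shuffleList]
  · rw [shuffle_singleton_right _ _ _ hl, ← barClass_translate (u * j (f b) * u⁻¹) (push j (of l)), push_of,
      push_of, List.map_map]
    congr 3
    funext a
    simp [hcomm]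

/-- The sum of the products of the values of `P` on the front faces with the back faces of positive
dimension. -/
noncomputable def crossHomotopy (f : G →* K) (j : K →* K') (u : K')
    (P : VertexChain G →ₗ[ℤ] VertexChain K) : VertexChain G →ₗ[ℤ] VertexChain K' :=
  diagonal ((shuffle fun k b => j k * (u * j (f b) * u⁻¹)).compl₁₂ P truncate)

theorem size_crossHomotopy (hP : IsNullHomotopy f n P) {w : List G} {m : ℕ}
    (hw : w.length = m + 1) :
    Size (m + 2) (∑ k ∈ Finset.range m, cFun k * (m + 1).choose (m - k))
      (crossHomotopy f j u P (of w)) := by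
  rw [crossHomotopy, diagonal_of_eq_sum, hw, Finset.sum_range_succ]
  simp only [LinearMap.compl₁₂_apply]
  -- The last cut has a back face of dimension 0, so c(m) itself does not occur on the right.
  rw [truncate_of_le (l := w.drop m) (by simp; omega), map_zero, add_zero]
  refine Size.sum _ _ _ fun k hk => ?_
  have hk := Finset.mem_range.1 hk
  have hl : (w.take (k + 1)).length = k + 1 := by simp; omega
  have hd : (w.drop k).length = m - k + 1 := by simp; omega
  rw [truncate_of_lt (by omega)]
  have h1 := hP.size (w.take (k + 1))
  rw [hl, Nat.add_sub_cancel] at h1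
  refine h1.map ((shuffle fun k b => j k * (u * j (f b) * u⁻¹)).flip (of (w.drop k)))
    (fun l hl => ?_) (fun l hl hdeg => ?_)
  · have := size_shuffle (fun k b => j k * (u * j (f b) * u⁻¹)) hl hd
    rw [show k + 1 + (m - k) = m + 1 by omega] at this
    rw [← Nat.choose_symm_of_eq_add (show m + 1 = (k + 1) + (m - k) by omega)]
    exact this
  · have := size_shuffle_of_degenerate (fun k b => j k * (u * j (f b) * u⁻¹)) hdeg (w.drop k)
    rw [hl, hd, show k + 1 + 1 + (m - k + 1) - 1 = m + 2 by omega] at this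
    exact this

theorem barClass_crossHomotopy_translate (hP : IsNullHomotopy f n P)
    (hcomm : ∀ a b : K, j a * (u * j b * u⁻¹) = u * j b * u⁻¹ * j a) (k : G) (w : List G) :
    barClass K' (crossHomotopy f j u P (of (w.map (k * ·))))
      = barClass K' (crossHomotopy f j u P (of w)) := by
  rw [crossHomotopy, map_diagonal, map_diagonal, diagonal_map]
  refine diagonal_congr w fun l m _ _ _ => ?_
  simp only [LinearMap.compl₁₂_apply, LinearMap.compr₂_apply]
  rw [← push_truncate, barClass_shuffle_translate hcomm, push_of,
    barClass_shuffle_congr (hP.invariant k l)]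

/-- By the Leibniz rule and the compatibility of the diagonal with boundaries, only the homotopy
formula for `P` on front faces contributes: it replaces `P` by `f` minus the constant map. -/
theorem barClass_boundary_crossHomotopy (hP : IsNullHomotopy f n P)
    (hcomm : ∀ a b : K, j a * (u * j b * u⁻¹) = u * j b * u⁻¹ * j a) {w : List G} (hw : w ≠ [])
    (hwn : w.length ≤ n + 2) :
    barClass K' (boundary (crossHomotopy f j u P (of w)) + crossHomotopy f j u P (boundary (of w)))
      = barClass K' (diagonal ((shuffle fun a b => j (f a) * (u * j (f b) * u⁻¹)).compl₂ truncate)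
          (of w) - push (fun b => u * j (f b) * u⁻¹) (truncate (of w))) := by
  set ν : K → G → K' := fun k b => j k * (u * j (f b) * u⁻¹) with hν
  set B := ((shuffle ν).compl₁₂ P truncate).compr₂ (barClass K') with hB
  set E := ((shuffle fun a b => j (f a) * (u * j (f b) * u⁻¹)).compl₂ truncate).compr₂
    (barClass K') with hE
  set F := ((shuffle ν).compl₁₂ (push fun _ : G => (1 : K)) truncate).compr₂ (barClass K') with hF
  have h1 : barClass K' (boundary (crossHomotopy f j u P (of w)))
      = diagonal (E - F - (B ∘ₗ boundary - B.compl₁₂ sgn boundary)) (of w) := by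
    have := map_diagonal (barClass K' ∘ₗ boundary) ((shuffle ν).compl₁₂ P truncate) (of w)
    rw [LinearMap.comp_apply] at this
    rw [crossHomotopy, this]
    refine diagonal_congr w fun l m hl hm hlm => ?_
    have hflip : barClass K' (shuffle ν (P (of l)) (boundary (truncate (of m))))
        = barClass K' (shuffle ν (P (of l)) (truncate (boundary (of m)))) :=
      (apply_truncate_boundary (barClass K' ∘ₗ shuffle ν (P (of l))) (fun a b => by
        simp only [LinearMap.comp_apply]
        rw [barClass_shuffle_singleton hcomm, barClass_shuffle_singleton hcomm]) (of m)).symm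
    have hmain : barClass K' (shuffle ν (boundary (P (of l))) (truncate (of m)))
        = barClass K' (shuffle ν (push f (of l) - push (fun _ => 1) (of l) - P (boundary (of l)))
          (truncate (of m))) := by
      -- If the back face has at least two vertices, the front face has at most n + 1, within the
      -- range of `P`. This is where one dimension is gained.
      by_cases h2 : 2 ≤ m.length
      · refine barClass_shuffle_congr ?_ _
        rw [map_sub (barClass K), ← hP.homotopy l (by omega), map_add, add_sub_cancel_right]
      · simp only [truncate_of_le (show m.length ≤ 1 by omega), map_zero]
    have hnat : shuffle ν (push f (of l)) (truncate (of m))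
        = shuffle (fun a b => j (f a) * (u * j (f b) * u⁻¹)) (of l) (truncate (of m)) := by
      have hid : push (id : G → G) (truncate (of m)) = truncate (of m) :=
        hom_congr (f := push id) (g := LinearMap.id) (by simp) _
      have := shuffle_push ν f id (of l) (truncate (of m))
      rwa [hid] at this
    simp only [LinearMap.compr₂_apply, LinearMap.compl₁₂_apply, LinearMap.sub_apply,
      LinearMap.comp_apply, LinearMap.compl₂_apply, hB, hE, hF]
    rw [boundary_shuffle, map_sub, hmain, (hP.size l).sgn_eq, map_smul, LinearMap.smul_apply,
      map_smul, hflip, sgn_of, map_smul, map_smul, LinearMap.smul_apply, map_smul, map_sub (shuffle ν),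
      map_sub (shuffle ν), LinearMap.sub_apply, LinearMap.sub_apply, map_sub, map_sub, hnat, pow_succ]
    simp only [mul_neg, mul_one, neg_smul]
    abel
  -- For the constant map only the first cut survives, since longer constant fronts repeat the
  -- vertex 1.
  have h2 : diagonal F (of w)
      = barClass K' (push (fun b => u * j (f b) * u⁻¹) (truncate (of w))) := by
    rcases w with _ | ⟨a, w⟩
    · exact absurd rfl hw
    have h0 : diagonal (F ∘ₗ cons a) (of w) = diagonal 0 (of w) := by
      refine diagonal_congr w fun l m hl hm _ => ?_
      rcases l with _ | ⟨b, l⟩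
      · exact absurd rfl hl
      simp only [LinearMap.comp_apply, hF, LinearMap.compr₂_apply, LinearMap.compl₁₂_apply, cons_of,
        push_of, LinearMap.zero_apply, truncate_of]
      split_ifs
      · exact barClass_of_size_zero (size_shuffle_of_degenerate _
          (not_nondegenerate_cons_cons (1 : K) (l.map fun _ => 1)) m)
      · simp
    rw [← cons_of, diagonal_cons, h0, diagonal_of_eq_sum]
    simp only [LinearMap.zero_apply, Finset.sum_const_zero, add_zero, hF, LinearMap.compr₂_apply,
      LinearMap.compl₁₂_apply, push_of, List.map_cons, List.map_nil, cons_of, truncate_of]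
    split_ifs
    · rw [shuffle_singleton_left _ _ _ (by simp), push_of, hν]
      simp
    · simp
  have h3 := diagonal_boundary B w
  have h4 : B (of []) (of w) = 0 := by
    simp [hB, hP.vanish [] (by simp)]
  have h5 : B (sgn (of w)) (of []) = 0 := by
    simp [hB, truncate_of]
  rw [map_add, h1, diagonal_sub, diagonal_sub, h2, h3, h4, h5, crossHomotopy, map_diagonal,
    map_sub, map_diagonal]
  abel

/-- The null homotopy of a homomorphism into a mitosis, on simplices of positive dimension. -/
noncomputable def mitosisHomotopy (f : G →* K) (j : K →* K') (u t : K')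
    (P : VertexChain G →ₗ[ℤ] VertexChain K) : VertexChain G →ₗ[ℤ] VertexChain K' :=
  prism (fun b => u * j (f b) * u⁻¹) (fun b => u * j (f b) * u⁻¹ * (t * u⁻¹)⁻¹)
    - diagonalHomotopy (fun a b => j (f a) * (u * j (f b) * u⁻¹)) - crossHomotopy f j u P

theorem size_mitosisHomotopy (hP : IsNullHomotopy f n P) {w : List G} (hw : 2 ≤ w.length) :
    Size (w.length + 1) (cFun (w.length - 1)) (mitosisHomotopy f j u t P (of w)) := by
  obtain ⟨m, hm⟩ : ∃ m, w.length = m + 1 := ⟨w.length - 1, by omega⟩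
  have h1 := (size_prism (fun b => u * j (f b) * u⁻¹)
    (fun b => u * j (f b) * u⁻¹ * (t * u⁻¹)⁻¹) w).sub
      (size_diagonalHomotopy (fun a b => j (f a) * (u * j (f b) * u⁻¹)) w)
  rw [hm] at h1 ⊢
  refine (h1.sub (size_crossHomotopy hP hm)).mono ?_
  -- The prism's m + 1 terms fill the gap between 2^(m+1) - (m+2) and 2 · 2^m - 1.
  have h2 := sum_two_pow_sub_one m
  have h3 := cFun_add_one (m := m) (by omega)
  rw [pow_succ] at h2
  rw [Nat.add_sub_cancel]
  omega

/-- Translating the source by `k` translates the prism by k^u and the diagonal homotopy by k · k^u.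
The summands need different elements, so the invariance holds only for classes. -/
theorem barClass_mitosisHomotopy_translate (hP : IsNullHomotopy f n P)
    (hcomm : ∀ a b : K, j a * (u * j b * u⁻¹) = u * j b * u⁻¹ * j a) (k : G) (w : List G) :
    barClass K' (mitosisHomotopy f j u t P (of (w.map (k * ·))))
      = barClass K' (mitosisHomotopy f j u t P (of w)) := by
  have h1 : prism (fun b => u * j (f b) * u⁻¹) (fun b => u * j (f b) * u⁻¹ * (t * u⁻¹)⁻¹)
      (of (w.map (k * ·))) = push (u * j (f k) * u⁻¹ * ·) (prism (fun b => u * j (f b) * u⁻¹)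
        (fun b => u * j (f b) * u⁻¹ * (t * u⁻¹)⁻¹) (of w)) := by
    rw [prism_push, push_prism]
    congr 2 <;> funext a <;> simp [mul_assoc]
  have h2 : diagonalHomotopy (fun a b => j (f a) * (u * j (f b) * u⁻¹)) (of (w.map (k * ·)))
      = push (j (f k) * (u * j (f k) * u⁻¹) * ·)
        (diagonalHomotopy (fun a b => j (f a) * (u * j (f b) * u⁻¹)) (of w)) := by
    rw [diagonalHomotopy_map, push_diagonalHomotopy]
    congr 2
    funext a b
    have := hcomm (f a) (f k)
    simp only [map_mul]
    calc _ = j (f k) * (j (f a) * (u * j (f k) * u⁻¹)) * (u * j (f b) * u⁻¹) := by group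
      _ = _ := by rw [this]; group
  simp only [mitosisHomotopy, LinearMap.sub_apply, map_sub]
  rw [h1, h2, barClass_translate, barClass_translate, barClass_crossHomotopy_translate hP hcomm]

theorem barClass_boundary_mitosisHomotopy (hP : IsNullHomotopy f n P)
    (hcomm : ∀ a b : K, j a * (u * j b * u⁻¹) = u * j b * u⁻¹ * j a)
    (hdiag : ∀ a : K, t * j a * t⁻¹ = j a * (u * j a * u⁻¹)) {w : List G} (hw : 2 ≤ w.length)
    (hwn : w.length ≤ n + 2) :
    barClass K' (boundary (mitosisHomotopy f j u t P (of w))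
        + mitosisHomotopy f j u t P (boundary (of w)))
      = barClass K' (push (j.comp f) (of w)) := by
  have hne : w ≠ [] := by rintro rfl; simp at hw
  have h1 := congrArg (barClass K') (boundary_prism (fun b => u * j (f b) * u⁻¹)
    (fun b => u * j (f b) * u⁻¹ * (t * u⁻¹)⁻¹) (of w))
  have h2 := congrArg (barClass K')
    (boundary_diagonalHomotopy (fun a b => j (f a) * (u * j (f b) * u⁻¹)) (of w))
  have h3 := barClass_boundary_crossHomotopy hP hcomm hne hwn
  -- The top of the prism differs from a^u by a right factor only; a left translation by t · u⁻¹
  -- completes this to conjugation and gives a^t = a · a^u.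
  have h4 : barClass K' (push (fun b => u * j (f b) * u⁻¹ * (t * u⁻¹)⁻¹) (of w))
      = barClass K' (push (fun a => j (f a) * (u * j (f a) * u⁻¹)) (of w)) := by
    rw [← barClass_translate (t * u⁻¹), push_of, push_of, push_of, List.map_map]
    congr 3
    funext a
    rw [← hdiag]
    simp [mul_assoc]
  have h5 := diagonal_truncate ((shuffle fun a b => j (f a) * (u * j (f b) * u⁻¹)).compr₂
    (barClass K')) (barClass K' ∘ₗ push (j.comp f)) (fun l b hl => by
      rw [LinearMap.compr₂_apply, shuffle_singleton_right _ _ _ hl, LinearMap.comp_apply,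
        ← barClass_translate (u * j (f b) * u⁻¹) (push _ _), push_of, push_of, List.map_map]
      congr 3
      funext a
      simp [hcomm]) w hne
  have h6 : ((shuffle fun a b => j (f a) * (u * j (f b) * u⁻¹)).compr₂ (barClass K')).compl₂ truncate
      = ((shuffle fun a b => j (f a) * (u * j (f b) * u⁻¹)).compl₂ truncate).compr₂ (barClass K') :=
    rfl
  rw [← map_diagonal, h6] at h5
  rw [shuffleDiagonal_of hne, map_sub, h5] at h2
  rw [truncate_of_lt hw, map_sub, map_diagonal] at h3
  rw [map_sub, h4] at h1
  simp only [mitosisHomotopy, LinearMap.sub_apply, map_sub, map_add] at h1 h2 h3 ⊢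
  rw [← eq_sub_iff_add_eq] at h1 h2 h3
  rw [h1, h2, h3, LinearMap.comp_apply]
  abel

/-- Truncation discards the edges that the prism assigns to vertices, as c(0) = 0 demands. The
homotopy formula survives because those edges all have the same class. -/
theorem IsNullHomotopy.mitosis (hP : IsNullHomotopy f n P)
    (hcomm : ∀ a b : K, j a * (u * j b * u⁻¹) = u * j b * u⁻¹ * j a)
    (hdiag : ∀ a : K, t * j a * t⁻¹ = j a * (u * j a * u⁻¹)) :
    IsNullHomotopy (j.comp f) (n + 1) (mitosisHomotopy f j u t P ∘ₗ truncate) where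
  size w := by
    by_cases hw : 2 ≤ w.length
    · rw [LinearMap.comp_apply, truncate_of_lt hw]
      exact size_mitosisHomotopy hP hw
    · rw [LinearMap.comp_apply, truncate_of_le (by omega), map_zero]
      exact Size.zero'
  vanish w hw := by rw [LinearMap.comp_apply, truncate_of_le hw, map_zero]
  invariant k w := by
    by_cases hw : 2 ≤ w.length
    · rw [LinearMap.comp_apply, LinearMap.comp_apply, truncate_of_lt hw,
        truncate_of_lt (by rwa [List.length_map]), barClass_mitosisHomotopy_translate hP hcomm]
    · rw [LinearMap.comp_apply, LinearMap.comp_apply, truncate_of_le (by rw [List.length_map]; omega),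
        truncate_of_le (by omega)]
  homotopy w hwn := by
    have h0 := apply_truncate_boundary (barClass K' ∘ₗ mitosisHomotopy f j u t P)
      (fun a b => by
        simpa using
          (barClass_mitosisHomotopy_translate (t := t) hP hcomm (b * a⁻¹) [a]).symm) (of w)
    simp only [LinearMap.comp_apply] at h0 ⊢
    rw [map_add, h0, ← map_add]
    by_cases hw : 2 ≤ w.length
    · rw [truncate_of_lt hw, barClass_boundary_mitosisHomotopy hP hcomm hdiag hw hwn, map_sub,
        eq_comm, sub_eq_self]
      -- It remains to see that the trivial homomorphism contributes nothing: a constant list with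
      -- at least two vertices is degenerate.
      rcases w with _ | ⟨a, _ | ⟨b, w⟩⟩
      · simp at hw
      · simp at hw
      · rw [push_of]
        exact barClass_of_degenerate (not_nondegenerate_cons_cons _ _)
    · rw [truncate_of_le (by omega)]
      simpa using (isNullHomotopy_zero (j.comp f)).homotopy w (by omega)

end Step

/-! ### Iteration over the mitosis powers. -/

theorem exists_isNullHomotopy {G : Type*} [Group G] (n : ℕ) :
    ∃ P : VertexChain G →ₗ[ℤ] VertexChain (mitosisPow G n), IsNullHomotopy (mitosisEmb G n) n P := by
  induction n with
  | zero => exact ⟨0, isNullHomotopy_zero _⟩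
  | succ n ih =>
    obtain ⟨P, hP⟩ := ih
    let π : Monoid.Coprod (mitosisPow G n) (FreeGroup Bool) →* Mitosis (mitosisPow G n) :=
      QuotientGroup.mk' (Subgroup.normalClosure (mitosisRelators (mitosisPow G n)))
    have hrel : ∀ r ∈ mitosisRelators (mitosisPow G n), π r = 1 := fun r hr =>
      (QuotientGroup.eq_one_iff r).2 (Subgroup.subset_normalClosure hr)
    refine ⟨_, hP.mitosis (j := Mitosis.of (mitosisPow G n)) (u := π (mitosisU _))
      (t := π (mitosisT _)) (fun a b => ?_) (fun a => ?_)⟩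
    · have h := hrel _ (Or.inr ⟨b, a, rfl⟩)
      simp only [map_mul, map_inv] at h
      exact (mul_inv_eq_iff_eq_mul.1 (mul_inv_eq_one.1 h)).symm
    · have h := hrel _ (Or.inl ⟨a, rfl⟩)
      rw [map_mul, map_inv, mul_inv_eq_one] at h
      simp only [map_mul, map_inv] at h
      exact h

end VertexChain

/-! ### Descent from vertex chains to the Moore and cellular complexes of classifying spaces. -/

section Descent

open CategoryTheory Simplicial Opposite BasedChainComplex VertexChain

theorem BasedChainComplex.diameter_add_le {ι : Type*} (x y : ι →₀ ℤ) :
    diameter (x + y) ≤ diameter x + diameter y := by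
  classical
  have h (z : ι →₀ ℤ) (hz : z.support ⊆ x.support ∪ y.support) :
      diameter z = ∑ i ∈ x.support ∪ y.support, (z i).natAbs :=
    Finsupp.sum_of_support_subset _ hz _ (by simp)
  rw [h _ Finsupp.support_add, h x Finset.subset_union_left, h y Finset.subset_union_right,
    ← Finset.sum_add_distrib]
  exact Finset.sum_le_sum fun i _ => Int.natAbs_add_le _ _

theorem BasedChainComplex.diameter_unit_smul_single {ι : Type*} (ε : ℤˣ) (i : ι) :
    diameter (ε • Finsupp.single i (1 : ℤ)) = 1 := by
  rw [Units.smul_def, Finsupp.smul_single, diameter, Finsupp.sum_single_index (by simp)]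
  simp

namespace VertexChain

variable {G H : Type u} [Group G] [Group H]

/-- The successive differences of a list of vertices. -/
def differences (m : ℕ) (l : List G) (i : Fin m) : G := (l.getD i 1)⁻¹ * l.getD (i + 1) 1

theorem partialProd_differences {m : ℕ} (l : List G) (j : Fin (m + 1)) :
    Fin.partialProd (differences m l) j = (l.getD 0 1)⁻¹ * l.getD j 1 := by
  induction j using Fin.induction with
  | zero => simp
  | succ j ih =>
    rw [Fin.partialProd_succ, ih]
    simp [differences, mul_assoc]

theorem differences_map {m : ℕ} (φ : G →* H) {l : List G} (h : l.length = m + 1) :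
    differences m (l.map φ) = fun i => φ (differences m l i) := by
  funext i
  simp only [differences]
  rw [List.getD_eq_getElem _ _ (by simp; omega), List.getD_eq_getElem _ _ (by simp; omega),
    List.getD_eq_getElem _ _ (by omega), List.getD_eq_getElem _ _ (by omega)]
  simp

theorem differences_translate {m : ℕ} (k : G) {l : List G} (h : l.length = m + 1) :
    differences m (l.map (k * ·)) = differences m l := by
  funext i
  simp only [differences]
  rw [List.getD_eq_getElem _ _ (by simp; omega), List.getD_eq_getElem _ _ (by simp; omega),
    List.getD_eq_getElem _ _ (by omega), List.getD_eq_getElem _ _ (by omega)]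
  simp [mul_assoc]

/-- The simplex of `BG` with given vertices of its lift to `EG`. -/
def barOfList (m : ℕ) (l : List G) : (classifyingSSet G) _⦋m⦌ := barSimplex (differences m l)

/-- The projection from chains of vertices to chains of `BG`. -/
noncomputable def toBar (m : ℕ) : VertexChain G →ₗ[ℤ] ((classifyingSSet G) _⦋m⦌ →₀ ℤ) :=
  lift fun l => if l.length = m + 1 then Finsupp.single (barOfList m l) 1 else 0

theorem toBar_of {m : ℕ} {l : List G} (h : l.length = m + 1) :
    toBar m (of l) = Finsupp.single (barOfList m l) 1 := by
  rw [toBar, lift_of, if_pos h]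

theorem toBar_of_ne {m : ℕ} {l : List G} (h : l.length ≠ m + 1) : toBar m (of l) = 0 := by
  rw [toBar, lift_of, if_neg h]

/-- The tuple of group elements which is a simplex of `BG`. -/
def barEntries {m : ℕ} (g : (classifyingSSet G) _⦋m⦌) : Fin m → G := g

/-- The vertices of the lift of a simplex of `BG` starting at the identity. -/
def verticesOf {m : ℕ} (g : (classifyingSSet G) _⦋m⦌) : List G :=
  List.ofFn (Fin.partialProd (barEntries g))

theorem length_verticesOf {m : ℕ} (g : (classifyingSSet G) _⦋m⦌) :
    (verticesOf g).length = m + 1 := by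
  simp [verticesOf]

theorem differences_verticesOf {m : ℕ} (g : (classifyingSSet G) _⦋m⦌) :
    differences m (verticesOf g) = barEntries g := by
  funext i
  rw [← Fin.partialProd_right_inv (barEntries g) i, differences,
    List.getD_eq_getElem _ _ (by rw [length_verticesOf]; omega),
    List.getD_eq_getElem _ _ (by rw [length_verticesOf]; omega)]
  simp only [verticesOf, List.getElem_ofFn]
  rfl

theorem barOfList_verticesOf {m : ℕ} (g : (classifyingSSet G) _⦋m⦌) :
    barOfList m (verticesOf g) = g := by
  rw [barOfList, differences_verticesOf]
  rfl

theorem verticesOf_barOfList {m : ℕ} {l : List G} (h : l.length = m + 1) :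
    verticesOf (barOfList m l) = l.map ((l.getD 0 1)⁻¹ * ·) := by
  have hb : barEntries (barOfList m l) = differences m l := rfl
  refine List.ext_getElem (by rw [length_verticesOf, List.length_map, h]) fun i h1 h2 => ?_
  simp only [verticesOf, List.getElem_ofFn, hb, partialProd_differences, List.getElem_map]
  congr 1
  exact List.getD_eq_getElem _ _ _

/-- The lift of chains of `BG` to chains of vertices. -/
noncomputable def fromBar (m : ℕ) : ((classifyingSSet G) _⦋m⦌ →₀ ℤ) →ₗ[ℤ] VertexChain G :=
  Finsupp.linearCombination ℤ fun g => of (verticesOf g)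

theorem fromBar_single {m : ℕ} (g : (classifyingSSet G) _⦋m⦌) :
    fromBar m (Finsupp.single g 1) = of (verticesOf g) := by
  rw [fromBar, Finsupp.linearCombination_single, one_smul]

theorem toBar_fromBar_single {m : ℕ} (g : (classifyingSSet G) _⦋m⦌) :
    toBar m (fromBar m (Finsupp.single g 1)) = Finsupp.single g 1 := by
  rw [fromBar_single, toBar_of (length_verticesOf _), barOfList_verticesOf]

theorem δ_barOfList {m : ℕ} (i : Fin (m + 2)) (l : List G) :
    (classifyingSSet G).δ i (barOfList (m + 1) l) = barOfList m (l.eraseIdx i) := by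
  -- The comparison goes through optional entries, so the default value 1 agrees on both sides and
  -- no condition on the length of `l` is needed.
  have key : ∀ j : Fin (m + 1), l.getD (i.succAbove j) 1 = (l.eraseIdx i).getD j 1 := by
    intro j
    rw [List.getD_eq_getElem?_getD, List.getD_eq_getElem?_getD, List.getElem?_eraseIdx]
    by_cases hji : j.castSucc < i
    · rw [Fin.succAbove_of_castSucc_lt _ _ hji, if_pos (by simpa [Fin.lt_def] using hji)]
      rfl
    · rw [Fin.succAbove_of_le_castSucc _ _ (not_lt.1 hji),
        if_neg (by simpa [Fin.lt_def] using hji)]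
      rfl
  funext k
  change (Fin.partialProd (differences (m + 1) l) (i.succAbove (Fin.castSucc (n := m) k)))⁻¹
    * Fin.partialProd (differences (m + 1) l) (i.succAbove (Fin.succ (n := m) k))
      = ((l.eraseIdx i).getD (Fin.castSucc (n := m) k) 1)⁻¹
        * (l.eraseIdx i).getD (Fin.succ (n := m) k) 1
  rw [partialProd_differences, partialProd_differences, key, key]
  simp [mul_assoc]

theorem mooreBoundary_toBar (m : ℕ) (x : VertexChain G) :
    mooreBoundary (classifyingSSet G) m (toBar (m + 1) x) = toBar m (boundary x) := by
  refine hom_congr (f := mooreBoundary (classifyingSSet G) m ∘ₗ toBar (m + 1))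
    (g := toBar m ∘ₗ boundary) (fun l => ?_) x
  simp only [LinearMap.comp_apply]
  rw [boundary_of_eq_sum, map_sum]
  by_cases h : l.length = m + 2
  · rw [toBar_of h, mooreBoundary_single, h, Finset.sum_range]
    refine Finset.sum_congr rfl fun i _ => ?_
    rw [map_smul, toBar_of (by rw [List.length_eraseIdx_of_lt (by omega)]; omega), δ_barOfList i]
  · rw [toBar_of_ne h, map_zero]
    refine (Finset.sum_eq_zero fun i hi => ?_).symm
    have hi := Finset.mem_range.1 hi
    rw [map_smul, toBar_of_ne (by rw [List.length_eraseIdx_of_lt hi]; omega), smul_zero]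

theorem toBar_translate {m : ℕ} (k : G) (l : List G) :
    toBar m (of (l.map (k * ·))) = toBar m (of l) := by
  by_cases h : l.length = m + 1
  · rw [toBar_of h, toBar_of (by simpa using h), barOfList, differences_translate k h, barOfList]
  · rw [toBar_of_ne h, toBar_of_ne (by simpa using h)]

theorem toBar_map {m : ℕ} (φ : G →* H) (g : (classifyingSSet G) _⦋m⦌) :
    toBar m (of ((verticesOf g).map φ)) = Finsupp.single ((classifyingMap φ).app (op ⦋m⦌) g) 1 := by
  rw [toBar_of (by rw [List.length_map, length_verticesOf]), barOfList,
    differences_map φ (length_verticesOf g), differences_verticesOf]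
  rfl

/-- The projection from chains of vertices to cellular chains of `BG`. -/
noncomputable def toCell (m : ℕ) :
    VertexChain G →ₗ[ℤ] ((classifyingSSet G).nonDegenerate m →₀ ℤ) :=
  nondegProj (classifyingSSet G) m ∘ₗ toBar m

theorem toCell_of_degenerate {m : ℕ} {l : List G} (hl : ¬ Nondegenerate l) :
    toCell m (of l) = 0 := by
  rw [toCell, LinearMap.comp_apply]
  by_cases h : l.length = m + 1
  · rw [toBar_of h, nondegProj_single_of_mem]
    refine (barSimplex_mem_degenerate_iff _).2 ?_
    rw [Nondegenerate, List.isChain_iff_getElem] at hl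
    push Not at hl
    obtain ⟨i, hi, he⟩ := hl
    refine ⟨⟨i, by omega⟩, ?_⟩
    rw [differences, List.getD_eq_getElem _ _ (by simp only; omega), List.getD_eq_getElem _ _ hi,
      he, inv_mul_cancel]
  · rw [toBar_of_ne h, map_zero]

theorem toCell_eq_of_barClass_eq {m : ℕ} {x y : VertexChain G}
    (h : barClass G x = barClass G y) : toCell m x = toCell m y :=
  map_eq_zero_of_barClass (fun _ hl => toCell_of_degenerate hl)
    (fun k l => by rw [toCell, LinearMap.comp_apply, LinearMap.comp_apply, toBar_translate]) h

theorem cellularBoundary_toCell (m : ℕ) (x : VertexChain G) :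
    cellularBoundary (classifyingSSet G) m (toCell (m + 1) x) = toCell m (boundary x) := by
  have h := LinearMap.congr_fun (cellularBoundary_comp_nondegProj (classifyingSSet G) m)
    (toBar (m + 1) x)
  rw [LinearMap.comp_apply, LinearMap.comp_apply, mooreBoundary_toBar] at h
  exact h

theorem toCell_push_fromBar {m : ℕ} (φ : G →* H) (g : (classifyingSSet G) _⦋m⦌) :
    toCell m (push φ (fromBar m (Finsupp.single g 1)))
      = (inducedChainMap φ).map m (Finsupp.single g 1) := by
  rw [fromBar_single, push_of, toCell, LinearMap.comp_apply, toBar_map]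
  change _ = nondegProj _ m (Finsupp.mapDomain _ (Finsupp.single g 1))
  rw [Finsupp.mapDomain_single]

theorem diameter_toCell_le {d n : ℕ} (m : ℕ) {x : VertexChain G} (h : Size d n x) :
    diameter (toCell m x) ≤ n := by
  induction h with
  | zero => simp [diameter]
  | succ _ ih => exact ih.trans (Nat.le_succ _)
  | add_of ε l hl _ ih =>
    rw [map_add]
    refine (diameter_add_le _ _).trans (add_le_add ih ?_)
    rw [Units.smul_def, map_smul, ← Units.smul_def]
    by_cases h : l.length = m + 1
    · by_cases hd : barOfList m l ∈ (classifyingSSet G).degenerate m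
      · rw [toCell, LinearMap.comp_apply, toBar_of h, nondegProj_single_of_mem _ _ _ hd]
        simp [diameter]
      · rw [toCell, LinearMap.comp_apply, toBar_of h,
          nondegProj_single _ _ ⟨barOfList m l, hd⟩, diameter_unit_smul_single]
    · rw [toCell, LinearMap.comp_apply, toBar_of_ne h]
      simp [diameter]
  | add_degenerate ε l hl hd _ ih =>
    rw [map_add, Units.smul_def, map_smul, toCell_of_degenerate hd, smul_zero, add_zero]
    exact ih

section NullHomotopy

variable {f : G →* H} {n : ℕ} {P : VertexChain G →ₗ[ℤ] VertexChain H}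

/-- The lift `fromBar` always starts at the identity and is not a chain map: the lift of a face
agrees with the face of the lift only up to translation. The invariance of `P` absorbs this. -/
theorem barClass_fromBar_mooreBoundary (hP : IsNullHomotopy f n P) {m : ℕ}
    (g : (classifyingSSet G) _⦋m + 1⦌) :
    barClass H (P (fromBar m (mooreBoundary (classifyingSSet G) m (Finsupp.single g 1))))
      = barClass H (P (boundary (fromBar (m + 1) (Finsupp.single g 1)))) := by
  rw [← toBar_fromBar_single g, mooreBoundary_toBar, toBar_fromBar_single, fromBar_single,
    boundary_of_eq_sum, length_verticesOf]
  simp only [map_sum, map_smul]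
  refine Finset.sum_congr rfl fun i hi => ?_
  have hi := Finset.mem_range.1 hi
  have hl : ((verticesOf g).eraseIdx i).length = m + 1 := by
    rw [List.length_eraseIdx_of_lt (by rw [length_verticesOf]; omega), length_verticesOf]
    omega
  rw [toBar_of hl, fromBar_single, verticesOf_barOfList hl, hP.invariant]

theorem IsNullHomotopy.toCell_homotopy (hP : IsNullHomotopy f n P) {m : ℕ} (hm : m ≤ n)
    (g : (classifyingSSet G) _⦋m⦌) :
    toCell m (boundary (P (fromBar m (Finsupp.single g 1)))
        + P (boundary (fromBar m (Finsupp.single g 1))))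
      = (inducedChainMap f).map m (Finsupp.single g 1)
        - (inducedChainMap (1 : G →* H)).map m (Finsupp.single g 1) := by
  refine Eq.trans ?_ (congrArg₂ (· - ·) (toCell_push_fromBar f g) (toCell_push_fromBar 1 g))
  refine Eq.trans ?_ (map_sub (toCell m) _ _)
  rw [fromBar_single]
  exact toCell_eq_of_barClass_eq (hP.homotopy _ (by rw [length_verticesOf]; omega))

/-- The partial chain homotopy obtained from a null homotopy on chains of vertices. -/
noncomputable def IsNullHomotopy.toPartialChainHomotopy (hP : IsNullHomotopy f n P) :
    PartialChainHomotopy (inducedChainMap f) (inducedChainMap (1 : G →* H)) n where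
  map m _ := toCell (m + 1) ∘ₗ P ∘ₗ fromBar m
  comm_zero := by
    refine Finsupp.lhom_ext' fun (g : (classifyingSSet G) _⦋0⦌) => LinearMap.ext_ring ?_
    refine Eq.trans ?_ (hP.toCell_homotopy (Nat.zero_le n) g)
    refine (cellularBoundary_toCell 0 _).trans ?_
    -- The augmentation term, absent from the unaugmented complex, is killed because `P` vanishes on
    -- the empty list.
    have h : P (boundary (fromBar 0 (Finsupp.single g 1))) = 0 := by
      rw [fromBar_single, boundary_of_eq_sum, map_sum]
      refine Finset.sum_eq_zero fun i hi => ?_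
      rw [map_smul, hP.vanish, smul_zero]
      rw [List.length_eraseIdx_of_lt (Finset.mem_range.1 hi), length_verticesOf]
      simp
    rw [h, add_zero]
    rfl
  comm_succ m hm := by
    refine Finsupp.lhom_ext' fun (g : (classifyingSSet G) _⦋m + 1⦌) => LinearMap.ext_ring ?_
    refine Eq.trans ?_ (hP.toCell_homotopy hm g)
    rw [map_add]
    exact congrArg₂ (· + ·) (cellularBoundary_toCell (m + 1) _)
      (toCell_eq_of_barClass_eq (barClass_fromBar_mooreBoundary hP g))

theorem IsNullHomotopy.controlledBy (hP : IsNullHomotopy f n P) :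
    hP.toPartialChainHomotopy.ControlledBy cFun := by
  refine fun k hk => iSup_le fun i => iSup_le fun hi => iSup_le fun
    (g : (classifyingSSet G) _⦋i⦌) => Nat.cast_le.2 ?_
  have h := hP.size (verticesOf g)
  rw [length_verticesOf, Nat.add_sub_cancel, ← fromBar_single] at h
  exact (diameter_toCell_le (i + 1) h).trans (cFun_monotone hi)

end NullHomotopy

end VertexChain

end Descent

theorem theorem4p3 :
    (∀ (G : Type u) [Group G] (n : ℕ),
      ∃ Φ : BasedChainComplex.PartialChainHomotopy
          (inducedChainMap (mitosisEmb G n))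
          (inducedChainMap (1 : G →* mitosisPow G n)) n,
        Φ.ControlledBy cFun) ∧
    (∀ m, qFun m ≤ gammaFun m) ∧
    (cFun 0 = 0 ∧ cFun 1 = 3 ∧ cFun 2 = 16 ∧ cFun 3 = 97 ∧ cFun 4 = 706 ∧ cFun 5 = 6119 ∧
      cFun 6 = 61804 ∧ cFun 7 = 713325) ∧
    (∀ m, 1 ≤ m →
      (cFun m : ℤ) = 2 * 2 ^ m - 1
        + ∑ k ∈ Finset.Icc 1 (m - 1), (cFun k : ℤ) * ((m + 1).choose (m - k) : ℤ)) := by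
  refine ⟨fun G _ n => ?_, qFun_le_gammaFun, cFun_values, fun m hm => cFun_cast_rec hm⟩
  obtain ⟨P, hP⟩ := VertexChain.exists_isNullHomotopy (G := G) n
  exact ⟨hP.toPartialChainHomotopy, hP.controlledBy⟩
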